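/- Let $n,m\ge 1$, $A,C,D\in\mathbb R^{n\times n}$, $B\in\mathbb R^{n\times m}$, let $Q\in\mathbb R^{n\times n}$ and $R\in\mathbb R^{m\times m}$ be symmetric positive definite, and let $\gamma>0$. Put $$\mathcal A=\begin{pmatrix}A&A+C-D\\0&D\end{pmatrix},\quad \mathcal B=\begin{pmatrix}B\\0\end{pmatrix},\quad \hat Q=\begin{pmatrix}Q&0\\0&0\end{pmatrix},$$ let $\Pi\in\mathbb R^{2n\times 2n}$ be symmetric positive definite, and write $\|\cdot\|$ for the Frobenius norm. Let $$\mathcal S=\{K\in\mathbb R^{m\times 2n}:\ M_K:=\mathcal A-\mathcal BK-\tfrac{\gamma}{2}I\ \text{is Hurwitz}\},$$ and for $K\in\mathcal S$ let $f(K)=\operatorname{tr}(P(K)\Pi)$ with $P(K)=\int_0^\infty e^{M_K^{T}\tau}(\hat Q+K^{T}RK)e^{M_K\tau}\,d\tau$. Let $K_0\in\mathcal S$ and $\mathcal S_{K_0}=\{K\in\mathcal S: f(K)\le f(K_0)\}$. Then: 1. $\mathcal S$ is open and $f$ is differentiable on $\mathcal S$; let $\nabla f$ be its gradient for the Frobenius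 inner product. 2. The Riccati equation $P\mathcal A+\mathcal A^{T}P-\gamma P-P\mathcal BR^{-1}\mathcal B^{T}P+\hat Q=0$ has exactly one positive semidefinite solution $P^*$; the gain $K^*=R^{-1}\mathcal B^{T}P^*$ lies in $\mathcal S$ and is the unique minimizer of $f$ over $\mathcal S$. 3. $\nabla f$ is Lipschitz on $\mathcal S_{K_0}$. Call $\mu>0$ a gradient dominance (Polyak-Łojasiewicz) constant if $\|\nabla f(K)\|^2\ge 2\mu\,(f(K)-f(K^*))$ for all $K\in\mathcal S_{K_0}$. Such a constant is $$\mu_0=\frac{\lambda_{\min}(R)\,\lambda_{\min}(\Pi)^2\,\lambda_{\min}(Q)}{48\, f(K_0)\left(\|\mathcal A\|+\tfrac{\gamma n}{2}+\frac{\|\mathcal B\|^2f(K_0)}{\lambda_{\min}(\Pi)\lambda_{\min}(R)}\right)^{2}}>0 .$$ 4. For every $t_0\in\mathbb R$ the gradient flow $\dot K=-\nabla f(K)$, $K(t_0)=K_0$, has a solution on $[t_0,\infty)$. Every solution on $[t_0,\infty)$ stays in $\mathcal S_{K_0}$ and satisfies $\lim_{t\to\infty}\nabla f(K(t))=0$.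 With $\phi(t)=f(K(t))-f(K^*)$, for every gradient dominance constant $\mu>0$ (in particular for $\mu=\mu_0$), every Lipschitz constant $L$ of $\nabla f$ on $\mathcal S_{K_0}$ and all $t\ge t_0$, $$\phi(t)\le\phi(t_0)\,e^{-2\mu(t-t_0)},\qquad \|K(t)-K^*\|\le\sqrt{\tfrac{2\phi(t_0)}{\mu}}\;e^{-\mu(t-t_0)},\qquad \|K(t)-K^*\|\le\frac{\sqrt{2L\,\phi(t_0)}}{\mu}\,e^{-\mu(t-t_0)} .$$ -/

import Mathlib

open Matrix Set Filter Topology MeasureTheory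

attribute [local instance] Matrix.frobeniusNormedAddCommGroup Matrix.frobeniusNormedSpace

noncomputable section

/-- A real square matrix is Hurwitz when all its complex eigenvalues have negative real part. -/
def IsHurwitz {ι : Type*} [Fintype ι] [DecidableEq ι] (M : Matrix ι ι ℝ) : Prop :=
  ∀ z ∈ spectrum ℂ (M.map (algebraMap ℝ ℂ)), z.re < 0

/-- Smallest real eigenvalue (used for symmetric matrices of positive size). -/
def lamMin {ι : Type*} [Fintype ι] [DecidableEq ι] (M : Matrix ι ι ℝ) : ℝ :=
  sInf (spectrum ℝ M)

/-- The gradient of a real function of a matrix with respect to the Frobenius inner product,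
that is, the matrix of its partial derivatives. -/
def matGrad {m ι : Type*} [Fintype m] [DecidableEq m] [Fintype ι] [DecidableEq ι]
    (f : Matrix m ι ℝ → ℝ) (K : Matrix m ι ℝ) : Matrix m ι ℝ :=
  Matrix.of fun i j => fderiv ℝ f K (Matrix.single i j 1)

/-- The data of a discounted linear-quadratic tracking problem: follower
`x' = A x + B u + C v`, leader `v' = D v`, weights `Q` (error) and `R` (input), discount `γ`,
and the weight `W` on initial augmented states in the cost `tr (P(K) W)`. -/
structure TrackingLQR (n m : ℕ) where
  A : Matrix (Fin n) (Fin n) ℝ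
  B : Matrix (Fin n) (Fin m) ℝ
  C : Matrix (Fin n) (Fin n) ℝ
  D : Matrix (Fin n) (Fin n) ℝ
  Q : Matrix (Fin n) (Fin n) ℝ
  R : Matrix (Fin m) (Fin m) ℝ
  γ : ℝ
  W : Matrix (Fin n ⊕ Fin n) (Fin n ⊕ Fin n) ℝ

namespace TrackingLQR

variable {n m : ℕ} (s : TrackingLQR n m)

/-- Drift matrix of the augmented state `(x - v, v)`. -/
def augA : Matrix (Fin n ⊕ Fin n) (Fin n ⊕ Fin n) ℝ :=
  Matrix.fromBlocks s.A (s.A + s.C - s.D) 0 s.D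

/-- Input matrix of the augmented state. -/
def augB : Matrix (Fin n ⊕ Fin n) (Fin m) ℝ :=
  Matrix.fromRows s.B 0

/-- State weight of the augmented state: only the tracking error is penalized. -/
def augQ : Matrix (Fin n ⊕ Fin n) (Fin n ⊕ Fin n) ℝ :=
  Matrix.fromBlocks s.Q 0 0 0

/-- Closed-loop matrix under the feedback `u = -K X`, shifted by the discount. -/
def closedLoop (K : Matrix (Fin m) (Fin n ⊕ Fin n) ℝ) :
    Matrix (Fin n ⊕ Fin n) (Fin n ⊕ Fin n) ℝ :=
  s.augA - s.augB * K - (s.γ / 2) • (1 : Matrix (Fin n ⊕ Fin n) (Fin n ⊕ Fin n) ℝ)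

/-- The set of stabilizing gains of the discounted augmented system. -/
def stabilizing : Set (Matrix (Fin m) (Fin n ⊕ Fin n) ℝ) :=
  {K | IsHurwitz (s.closedLoop K)}

/-- The value matrix `P(K) = ∫₀^∞ exp(τ Mᵀ) (Q̂ + Kᵀ R K) exp(τ M) dτ`, where `M` is the shifted
closed-loop matrix; the integral is taken entrywise. -/
def valueMatrix (K : Matrix (Fin m) (Fin n ⊕ Fin n) ℝ) :
    Matrix (Fin n ⊕ Fin n) (Fin n ⊕ Fin n) ℝ :=
  Matrix.of fun i j => ∫ τ in Ioi (0 : ℝ),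
    (NormedSpace.exp (τ • (s.closedLoop K)ᵀ) * (s.augQ + Kᵀ * s.R * K) *
      NormedSpace.exp (τ • s.closedLoop K)) i j

/-- The cost `f(K) = tr (P(K) W)`; it is only used at stabilizing gains (elsewhere the cost
is understood to be `+∞`). -/
def cost (K : Matrix (Fin m) (Fin n ⊕ Fin n) ℝ) : ℝ :=
  Matrix.trace (s.valueMatrix K * s.W)

/-- The gradient of the cost. -/
def grad (K : Matrix (Fin m) (Fin n ⊕ Fin n) ℝ) : Matrix (Fin m) (Fin n ⊕ Fin n) ℝ :=
  matGrad s.cost K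

/-- The sublevel set of the cost at the gain `K₀`. -/
def sublevel (K₀ : Matrix (Fin m) (Fin n ⊕ Fin n) ℝ) : Set (Matrix (Fin m) (Fin n ⊕ Fin n) ℝ) :=
  {K | K ∈ s.stabilizing ∧ s.cost K ≤ s.cost K₀}

/-- The discounted algebraic Riccati equation. -/
def Riccati (P : Matrix (Fin n ⊕ Fin n) (Fin n ⊕ Fin n) ℝ) : Prop :=
  P * s.augA + s.augAᵀ * P - s.γ • P - P * s.augB * s.R⁻¹ * s.augBᵀ * P + s.augQ = 0

/-- `K` solves the gradient flow `K' = -∇f(K)` on `[t₀, ∞)` with `K(t₀) = K₀`. -/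
def IsGradientFlow (t₀ : ℝ) (K₀ : Matrix (Fin m) (Fin n ⊕ Fin n) ℝ)
    (K : ℝ → Matrix (Fin m) (Fin n ⊕ Fin n) ℝ) : Prop :=
  K t₀ = K₀ ∧ ∀ t, t₀ ≤ t → HasDerivWithinAt K (-s.grad (K t)) (Ici t₀) t

/-- The cost is gradient dominated on `S` with constant `μ`, relative to the value at `Kopt`
(Polyak-Lojasiewicz inequality). -/
def PLOn (μ : ℝ) (S : Set (Matrix (Fin m) (Fin n ⊕ Fin n) ℝ))
    (Kopt : Matrix (Fin m) (Fin n ⊕ Fin n) ℝ) : Prop :=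
  ∀ K ∈ S, 2 * μ * (s.cost K - s.cost Kopt) ≤ ‖s.grad K‖ ^ 2

/-- An explicit rate in terms of the data and of the initial cost. -/
def rate (K₀ : Matrix (Fin m) (Fin n ⊕ Fin n) ℝ) : ℝ :=
  lamMin s.R * lamMin s.W ^ 2 * lamMin s.Q /
    (48 * s.cost K₀ * (‖s.augA‖ + s.γ * n / 2 +
      ‖s.augB‖ ^ 2 * s.cost K₀ / (lamMin s.W * lamMin s.R)) ^ 2)

end TrackingLQR

end

noncomputable section

attribute [local instance] Matrix.frobeniusNormedRing Matrix.frobeniusNormedAlgebra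

/-! ### Exponential decay -/

/-! Everything rests on Lyapunov equations. For Hurwitz M the decay of exp(tM) makes `lyapInt M N`
the unique solution of MᵀX + XM = -N. Hence P(K) and the correlation matrix Y(K) = `gram K` depend
smoothly on K, and by trace duality f(K) = tr((Q̂ + KᵀRK) Y(K)). Subtracting two Lyapunov equations
gives the exact formula `cost_sub_cost`: with F = RK - 𝓑ᵀP(K) (`gap`) and H = K' - K, the difference
f(K') - f(K) equals 2 tr(F Y(K') Hᵀ) + tr(R H Y(K') Hᵀ). From it follow the gradient 2 F Y(K), the
fact that a stabilizing zero of F is the unique minimizer, and, by completing the square,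
λmin(R)(f(K) - f(K')) ≤ tr(F Y(K') Fᵀ).

The difficulty is that Q̂ is only semidefinite, so the cost controls only the upper left block of
Y(K). But the leader block of the closed loop does not depend on K, so the lower right block of Y(K)
is the same for all stabilizing gains. This bounds Y on sublevel sets; together with a lower bound
for λmin(Y(K)) (`lamMin_W_le`) it makes sublevel sets compact (`isCompact_sublevel`), and it lets
Y(K') be exchanged for Y(K) in the gradient dominance estimate (`lamMin_gram_sq_mul_cost_sub_le`).
Compactness supplies a minimizer and the Lipschitz constant. When RK = 𝓑ᵀP the Riccati equation for
P is the Lyapunov equation of the gain K; a semidefinite solution therefore yields a stabilizing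
critical gain, and uniqueness of the minimizer gives uniqueness of the solution.

The flow is treated abstractly. Cutting off the gradient outside a compact sublevel set gives a
globally solvable equation whose solution never leaves that set, hence solves the original flow. The
decay of f is Gronwall's argument, and the distance bounds come from Łojasiewicz's length estimate
(`norm_gradientFlow_sub_le`), since √(f - f*) decreases at least at rate √(μ/2) times the speed. -/

theorem exists_norm_exp_smul_le_of_norm_pow_lt {𝔸 : Type*} [NormedRing 𝔸] [NormedAlgebra ℝ 𝔸]
    [CompleteSpace 𝔸] (a : 𝔸) {k : ℕ} (hk : 0 < k) (h : ‖NormedSpace.exp a ^ k‖ < 1) :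
    ∃ C α : ℝ, 0 ≤ C ∧ 0 < α ∧
      ∀ t : ℝ, 0 ≤ t → ‖NormedSpace.exp (t • a)‖ ≤ C * Real.exp (-(α * t)) := by
  let _ : NormedAlgebra ℚ 𝔸 := NormedAlgebra.restrictScalars ℚ ℝ 𝔸
  obtain ⟨r, hr, hr1⟩ := exists_between h
  have hr0 : 0 < r := (norm_nonneg _).trans_lt hr
  have hcont : Continuous fun t : ℝ => NormedSpace.exp (t • a) :=
    NormedSpace.exp_continuous.comp (continuous_id.smul continuous_const)
  obtain ⟨C, hC⟩ := (isCompact_Icc (a := (0 : ℝ)) (b := k)).exists_bound_of_continuousOn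
    hcont.continuousOn
  have hC0 : 0 ≤ C := (norm_nonneg _).trans (hC 0 ⟨le_rfl, by positivity⟩)
  have hk' : (0 : ℝ) < k := by exact_mod_cast hk
  -- Write t = jk + remainder with j = ⌊t/k⌋. The factor exp(-log r) = 1/r pays for j > t/k - 1, and
  -- ‖1‖ + 1 covers j = 0, since the norm of the unit need not be 1.
  refine ⟨C * ‖(1 : 𝔸)‖ * Real.exp (-Real.log r) + C * Real.exp (-Real.log r), -Real.log r / k,
    by positivity, div_pos (neg_pos.2 (Real.log_neg hr0 hr1)) hk', fun t ht => ?_⟩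
  set j := ⌊t / k⌋₊ with hj
  have hj1 : (j : ℝ) ≤ t / k := Nat.floor_le (by positivity)
  have hj2 : t / k < j + 1 := Nat.lt_floor_add_one _
  have hs : t - j * k ∈ Icc (0 : ℝ) k := by
    rw [le_div_iff₀ hk'] at hj1
    rw [div_lt_iff₀ hk'] at hj2
    constructor <;> nlinarith
  have hsplit : NormedSpace.exp (t • a) =
      (NormedSpace.exp a ^ k) ^ j * NormedSpace.exp ((t - j * k) • a) := by
    rw [← pow_mul, ← NormedSpace.exp_nsmul, ← NormedSpace.exp_add_of_commute]
    · congr 1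
      rw [← Nat.cast_smul_eq_nsmul ℝ, ← add_smul]
      push_cast
      ring_nf
    · exact ((Commute.refl a).smul_right _).smul_left _
  have hpow : ‖(NormedSpace.exp a ^ k) ^ j‖ ≤ (‖(1 : 𝔸)‖ + 1) * r ^ j := by
    rcases Nat.eq_zero_or_pos j with h0 | h0
    · simp [h0]
    · calc _ ≤ ‖NormedSpace.exp a ^ k‖ ^ j := norm_pow_le' _ h0
        _ ≤ r ^ j := by gcongr
        _ ≤ _ := by nlinarith [norm_nonneg (1 : 𝔸), pow_pos hr0 j]
  have hrj : r ^ j ≤ Real.exp (-Real.log r) * Real.exp (-(-Real.log r / k * t)) := by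
    rw [← Real.exp_add, ← Real.exp_log (pow_pos hr0 j), Real.log_pow]
    apply Real.exp_le_exp.2
    have := Real.log_neg hr0 hr1
    have e : -Real.log r + -(-Real.log r / k * t) = Real.log r * (t / k - 1) := by ring
    rw [e]
    nlinarith
  rw [hsplit]
  calc _ ≤ ‖(NormedSpace.exp a ^ k) ^ j‖ * ‖NormedSpace.exp ((t - j * k) • a)‖ := norm_mul_le _ _
    _ ≤ ((‖(1 : 𝔸)‖ + 1) * r ^ j) * C := by gcongr; exact hC _ hs
    _ ≤ ((‖(1 : 𝔸)‖ + 1) * (Real.exp (-Real.log r) * Real.exp (-(-Real.log r / k * t)))) * C := by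
        gcongr
    _ = _ := by ring

/-! ### Spectrum of the exponential and Hurwitz matrices -/

section Hurwitz

variable {ι : Type*} [Fintype ι] [DecidableEq ι]

theorem Matrix.mem_spectrum_iff_exists_mulVec {F : Type*} [Field F] (M : Matrix ι ι F) (z : F) :
    z ∈ spectrum F M ↔ ∃ v, v ≠ 0 ∧ M *ᵥ v = z • v := by
  rw [spectrum.mem_iff, Matrix.isUnit_iff_isUnit_det, isUnit_iff_ne_zero, not_not,
    ← Matrix.exists_mulVec_eq_zero_iff]
  refine exists_congr fun v => and_congr_right fun _ => ?_
  rw [Matrix.sub_mulVec, Algebra.algebraMap_eq_smul_one, Matrix.smul_mulVec,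
    Matrix.one_mulVec, sub_eq_zero, eq_comm]

theorem Matrix.exp_mulVec_of_mulVec_eq {M : Matrix ι ι ℂ} {z : ℂ} {v : ι → ℂ}
    (h : M *ᵥ v = z • v) : NormedSpace.exp M *ᵥ v = NormedSpace.exp z • v := by
  have h1 : HasSum (fun k : ℕ => ((k.factorial : ℂ)⁻¹ • M ^ k) *ᵥ v) (NormedSpace.exp M *ᵥ v) :=
    (NormedSpace.exp_series_hasSum_exp' (𝕂 := ℂ) M).map (Matrix.mulVecBilin ℂ ℂ |>.flip v)
      (continuous_id.matrix_mulVec continuous_const)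
  have h2 : HasSum (fun k : ℕ => ((k.factorial : ℂ)⁻¹ • z ^ k) • v) (NormedSpace.exp z • v) :=
    (NormedSpace.exp_series_hasSum_exp' (𝕂 := ℂ) z).smul_const v
  have hp : ∀ k : ℕ, M ^ k *ᵥ v = z ^ k • v := by
    intro k
    induction k with
    | zero => simp
    | succ k ih => rw [pow_succ, ← Matrix.mulVec_mulVec, h, Matrix.mulVec_smul, ih, smul_smul,
        pow_succ, mul_comm]
  refine h1.unique ?_
  convert h2 using 2 with k
  rw [Matrix.smul_mulVec, hp, smul_assoc]

/-- M commutes with its exponential, so it preserves the eigenspace for w and has an eigenvector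
there; on that vector the exponential acts both as w and as exp z. -/
theorem Matrix.exists_mem_spectrum_of_mem_spectrum_exp {M : Matrix ι ι ℂ} {w : ℂ}
    (hw : w ∈ spectrum ℂ (NormedSpace.exp M)) : ∃ z ∈ spectrum ℂ M, NormedSpace.exp z = w := by
  obtain ⟨v, hv, hvw⟩ := (Matrix.mem_spectrum_iff_exists_mulVec _ _).1 hw
  have hcomm : Commute (Matrix.toLin' (NormedSpace.exp M)) (Matrix.toLin' M) := by
    have : Commute (NormedSpace.exp M) M := (Commute.refl M).exp_left
    rw [commute_iff_eq] at this ⊢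
    rw [Module.End.mul_eq_comp, Module.End.mul_eq_comp, ← Matrix.toLin'_mul, ← Matrix.toLin'_mul,
      this]
  set U := Module.End.eigenspace (Matrix.toLin' (NormedSpace.exp M)) w with hU
  have hmaps : ∀ x ∈ U, Matrix.toLin' M x ∈ U :=
    Module.End.mapsTo_genEigenspace_of_comm hcomm w 1
  have hvU : v ∈ U := by
    rw [hU, Module.End.mem_eigenspace_iff, Matrix.toLin'_apply, hvw]
  have : Nontrivial U := ⟨⟨v, hvU⟩, 0, fun h => hv (congrArg Subtype.val h)⟩
  obtain ⟨z, hz⟩ := Module.End.exists_eigenvalue ((Matrix.toLin' M).restrict hmaps)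
  obtain ⟨⟨u, huU⟩, hu⟩ := hz.exists_hasEigenvector
  have hu0 : u ≠ 0 := fun h => hu.2 (Subtype.ext h)
  have hMu : M *ᵥ u = z • u := by
    have := congrArg Subtype.val hu.apply_eq_smul
    simpa using this
  refine ⟨z, (Matrix.mem_spectrum_iff_exists_mulVec _ _).2 ⟨u, hu0, hMu⟩, ?_⟩
  have h1 := Matrix.exp_mulVec_of_mulVec_eq hMu
  rw [hU, Module.End.mem_eigenspace_iff, Matrix.toLin'_apply, h1] at huU
  exact smul_left_injective ℂ hu0 huU

/-- The eigenvalues of exp M have modulus exp(Re z) < 1, so by Gelfand's formula some power of exp M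
has norm below 1. Complexification preserves the Frobenius norm, which transfers this back to the
real matrix. -/
theorem IsHurwitz.exists_norm_exp_smul_le {M : Matrix ι ι ℝ} (hM : IsHurwitz M) :
    ∃ C α : ℝ, 0 ≤ C ∧ 0 < α ∧
      ∀ t : ℝ, 0 ≤ t → ‖NormedSpace.exp (t • M)‖ ≤ C * Real.exp (-(α * t)) := by
  rcases isEmpty_or_nonempty ι with hι | hι
  · refine ⟨0, 1, le_rfl, one_pos, fun t _ => ?_⟩
    have : NormedSpace.exp (t • M) = 0 := Subsingleton.elim _ _
    simp [this]
  set A : Matrix ι ι ℂ := M.map (algebraMap ℝ ℂ) with hA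
  have hmap : ∀ X : Matrix ι ι ℝ, (NormedSpace.exp X).map (algebraMap ℝ ℂ) =
      NormedSpace.exp (X.map (algebraMap ℝ ℂ)) := fun X => by
    let _ : NormedAlgebra ℚ (Matrix ι ι ℝ) := NormedAlgebra.restrictScalars ℚ ℝ _
    exact NormedSpace.map_exp ((algebraMap ℝ ℂ).mapMatrix)
      (continuous_id.matrix_map Complex.continuous_ofReal) X
  have hnorm : ∀ X : Matrix ι ι ℝ, ‖X.map (algebraMap ℝ ℂ)‖ = ‖X‖ := fun X =>
    Matrix.frobenius_norm_map_eq X _ (by simp)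
  have hlt : spectralRadius ℂ (NormedSpace.exp A) < 1 := by
    refine spectrum.spectralRadius_lt_of_forall_lt _ fun z hz => ?_
    obtain ⟨w, hw, rfl⟩ := Matrix.exists_mem_spectrum_of_mem_spectrum_exp hz
    have := hM w hw
    rw [← Complex.exp_eq_exp_ℂ, ← NNReal.coe_lt_coe, coe_nnnorm, Complex.norm_exp]
    simpa using this
  have hev := (spectrum.pow_nnnorm_pow_one_div_tendsto_nhds_spectralRadius
    (NormedSpace.exp A)).eventually_lt_const hlt
  obtain ⟨k, hk, hk0⟩ := (hev.and (eventually_gt_atTop 0)).exists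
  refine exists_norm_exp_smul_le_of_norm_pow_lt M hk0 ?_
  have hpow : ‖NormedSpace.exp M ^ k‖ = ‖NormedSpace.exp A ^ k‖ := by
    rw [← hnorm, Matrix.map_pow]
    exact congrArg (fun X => ‖X ^ k‖) (hmap M)
  refine hpow.trans_lt ?_
  by_contra hcon
  have h1 : (1 : ENNReal) ≤ ‖NormedSpace.exp A ^ k‖₊ := by
    rw [← ENNReal.coe_one, ENNReal.coe_le_coe, ← NNReal.coe_le_coe]
    exact not_lt.1 hcon
  exact absurd hk (not_lt.2 (ENNReal.one_le_rpow h1 (by positivity)))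

theorem IsHurwitz.transpose {M : Matrix ι ι ℝ} (hM : IsHurwitz M) : IsHurwitz Mᵀ := by
  intro z hz
  refine hM z ?_
  rw [spectrum.mem_iff, Matrix.isUnit_iff_isUnit_det] at hz ⊢
  rw [← Matrix.det_transpose] at hz
  convert hz using 3
  rw [Matrix.transpose_sub, ← Matrix.transpose_map, Matrix.transpose_transpose,
    Algebra.algebraMap_eq_smul_one, Matrix.transpose_smul, Matrix.transpose_one]

/-- The two equations are the real and imaginary parts of M(x + iy) = (a + ib)(x + iy); this form
keeps later eigenvector arguments over ℝ. -/
theorem isHurwitz_iff_real {M : Matrix ι ι ℝ} :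
    IsHurwitz M ↔ ∀ (a b : ℝ) (x y : ι → ℝ), 0 ≤ a → M *ᵥ x = a • x - b • y →
      M *ᵥ y = b • x + a • y → x = 0 ∧ y = 0 := by
  constructor
  · intro hM a b x y ha hx hy
    by_contra hne
    have hv : (fun i => (⟨x i, y i⟩ : ℂ)) ≠ 0 := fun h => hne
      ⟨funext fun i => congrArg Complex.re (congrFun h i),
        funext fun i => congrArg Complex.im (congrFun h i)⟩
    refine absurd (hM ⟨a, b⟩ ((Matrix.mem_spectrum_iff_exists_mulVec _ _).2 ⟨_, hv, ?_⟩))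
      (not_lt.2 ha)
    funext i
    have hxi := congrFun hx i
    have hyi := congrFun hy i
    simp only [Matrix.mulVec, dotProduct, Pi.sub_apply, Pi.add_apply, Pi.smul_apply,
      smul_eq_mul] at hxi hyi
    apply Complex.ext
    · simp [Matrix.mulVec, dotProduct, hxi]
    · simp [Matrix.mulVec, dotProduct, hyi, add_comm]
  · intro h z hz
    by_contra hre
    obtain ⟨v, hv, hvz⟩ := (Matrix.mem_spectrum_iff_exists_mulVec _ _).1 hz
    have := h z.re z.im (fun i => (v i).re) (fun i => (v i).im) (not_lt.1 hre) ?_ ?_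
    · exact hv (funext fun i => Complex.ext (congrFun this.1 i) (congrFun this.2 i))
    · funext i
      simpa [Matrix.mulVec, dotProduct] using congrArg Complex.re (congrFun hvz i)
    · funext i
      have := congrArg Complex.im (congrFun hvz i)
      simp [Matrix.mulVec, dotProduct] at this ⊢
      linarith

end Hurwitz

end

noncomputable section

attribute [local instance] Matrix.frobeniusNormedRing Matrix.frobeniusNormedAlgebra

set_option linter.unusedSectionVars false

/-! ### Lyapunov equations -/

section Lyapunov

variable {ι : Type*} [Fintype ι] [DecidableEq ι]

theorem Matrix.posSemidef_real_iff {M : Matrix ι ι ℝ} :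
    M.PosSemidef ↔ Mᵀ = M ∧ ∀ x, 0 ≤ x ⬝ᵥ (M *ᵥ x) := by
  rw [Matrix.posSemidef_iff_dotProduct_mulVec]
  simp [Matrix.IsHermitian]

theorem Matrix.posDef_real_iff {M : Matrix ι ι ℝ} :
    M.PosDef ↔ Mᵀ = M ∧ ∀ x, x ≠ 0 → 0 < x ⬝ᵥ (M *ᵥ x) := by
  rw [Matrix.posDef_iff_dotProduct_mulVec]
  simp [Matrix.IsHermitian]

theorem Matrix.abs_apply_le_frobenius_norm {κ : Type*} [Fintype κ] (X : Matrix ι κ ℝ) (i : ι)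
    (j : κ) : |X i j| ≤ ‖X‖ := by
  rw [Matrix.frobenius_norm_def, ← Real.sqrt_eq_rpow]
  apply Real.le_sqrt_of_sq_le
  have h1 := Finset.single_le_sum (f := fun j => ‖X i j‖ ^ (2 : ℝ)) (fun _ _ => by positivity)
    (Finset.mem_univ j)
  have h2 := Finset.single_le_sum (f := fun i => ∑ j, ‖X i j‖ ^ (2 : ℝ))
    (fun _ _ => Finset.sum_nonneg fun _ _ => by positivity) (Finset.mem_univ i)
  simp only [Real.rpow_two, Real.norm_eq_abs] at h1 h2 ⊢
  exact h1.trans h2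

theorem hasDerivAt_exp_mul_mul_exp (M X : Matrix ι ι ℝ) (t : ℝ) :
    HasDerivAt (fun t : ℝ => NormedSpace.exp (t • Mᵀ) * X * NormedSpace.exp (t • M))
      (NormedSpace.exp (t • Mᵀ) * (Mᵀ * X + X * M) * NormedSpace.exp (t • M)) t := by
  refine (((hasDerivAt_exp_smul_const Mᵀ t).mul_const X).mul
    (hasDerivAt_exp_smul_const' M t)).congr_deriv ?_
  noncomm_ring

theorem LinearMap.hasDerivAt_comp_matrix {κ E : Type*} [Fintype κ] [NormedAddCommGroup E]
    [NormedSpace ℝ E] (g : Matrix ι κ ℝ →ₗ[ℝ] E) {F : ℝ → Matrix ι κ ℝ} {F' : Matrix ι κ ℝ} {t : ℝ}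
    (h : HasDerivAt F F' t) : HasDerivAt (fun t => g (F t)) (g F') t :=
  (LinearMap.toContinuousLinearMap g).hasFDerivAt.comp_hasDerivAt t h

/-- The quadratic form `Z ↦ xᵀ Z x` as a linear functional of the matrix `Z`. -/
def quadFormAt (x : ι → ℝ) : Matrix ι ι ℝ →ₗ[ℝ] ℝ where
  toFun Z := x ⬝ᵥ (Z *ᵥ x)
  map_add' Z₁ Z₂ := by rw [Matrix.add_mulVec, dotProduct_add]
  map_smul' c Z := by rw [Matrix.smul_mulVec, dotProduct_smul]; rfl

theorem quadFormAt_apply (x : ι → ℝ) (Z : Matrix ι ι ℝ) : quadFormAt x Z = x ⬝ᵥ (Z *ᵥ x) := rfl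

theorem IsHurwitz.exists_norm_exp_mul_mul_exp_le {M : Matrix ι ι ℝ} (hM : IsHurwitz M)
    (N : Matrix ι ι ℝ) : ∃ C α : ℝ, 0 ≤ C ∧ 0 < α ∧ ∀ t : ℝ, 0 ≤ t →
      ‖NormedSpace.exp (t • Mᵀ) * N * NormedSpace.exp (t • M)‖ ≤ C * Real.exp (-α * t) := by
  obtain ⟨C, α, hC, hα, h⟩ := hM.exists_norm_exp_smul_le
  obtain ⟨C', α', hC', hα', h'⟩ := hM.transpose.exists_norm_exp_smul_le
  refine ⟨C' * ‖N‖ * C, α' + α, by positivity, by positivity, fun t ht => ?_⟩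
  calc _ ≤ ‖NormedSpace.exp (t • Mᵀ)‖ * ‖N‖ * ‖NormedSpace.exp (t • M)‖ :=
        (norm_mul_le _ _).trans (by gcongr; exact norm_mul_le _ _)
    _ ≤ (C' * Real.exp (-(α' * t))) * ‖N‖ * (C * Real.exp (-(α * t))) := by
        gcongr
        · exact h' t ht
        · exact h t ht
    _ = (C' * ‖N‖ * C) * (Real.exp (-(α' * t)) * Real.exp (-(α * t))) := by ring
    _ = _ := by rw [← Real.exp_add]; ring_nf

theorem IsHurwitz.tendsto_exp_mul_mul_exp {M : Matrix ι ι ℝ} (hM : IsHurwitz M)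
    (N : Matrix ι ι ℝ) :
    Tendsto (fun t : ℝ => NormedSpace.exp (t • Mᵀ) * N * NormedSpace.exp (t • M)) atTop (𝓝 0) := by
  obtain ⟨C, α, hC, hα, h⟩ := hM.exists_norm_exp_mul_mul_exp_le N
  refine squeeze_zero_norm' ((eventually_ge_atTop 0).mono h) ?_
  have : Tendsto (fun t : ℝ => -α * t) atTop atBot :=
    tendsto_id.const_mul_atTop_of_neg (neg_lt_zero.2 hα)
  simpa using (Real.tendsto_exp_atBot.comp this).const_mul C

theorem IsHurwitz.integrableOn_exp_mul_mul_exp {M : Matrix ι ι ℝ} (hM : IsHurwitz M)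
    (N : Matrix ι ι ℝ) (i j : ι) :
    IntegrableOn (fun t : ℝ => (NormedSpace.exp (t • Mᵀ) * N * NormedSpace.exp (t • M)) i j)
      (Ioi 0) := by
  obtain ⟨C, α, hC, hα, h⟩ := hM.exists_norm_exp_mul_mul_exp_le N
  refine Integrable.mono' ((exp_neg_integrableOn_Ioi 0 hα).const_mul C) ?_ ?_
  · refine Continuous.aestronglyMeasurable (Continuous.matrix_elem ?_ i j)
    exact continuous_iff_continuousAt.2 fun t => (hasDerivAt_exp_mul_mul_exp M N t).continuousAt
  · refine (ae_restrict_iff' measurableSet_Ioi).2 (ae_of_all _ fun t ht => ?_)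
    exact (Matrix.abs_apply_le_frobenius_norm _ i j).trans (h t (le_of_lt ht))

/-- The matrix `∫₀^∞ exp(τ Mᵀ) N exp(τ M) dτ`, with the integral taken entrywise. -/
def lyapInt (M N : Matrix ι ι ℝ) : Matrix ι ι ℝ :=
  Matrix.of fun i j => ∫ τ in Ioi (0 : ℝ),
    (NormedSpace.exp (τ • Mᵀ) * N * NormedSpace.exp (τ • M)) i j

/-- The integrand is the derivative of exp(tMᵀ) X exp(tM), which goes from X at 0 to 0 at infinity.
-/
theorem IsHurwitz.lyapInt_lyapunov {M : Matrix ι ι ℝ} (hM : IsHurwitz M) (X : Matrix ι ι ℝ) :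
    lyapInt M (Mᵀ * X + X * M) = -X := by
  ext i j
  have hd : ∀ t : ℝ, HasDerivAt
      (fun t : ℝ => (NormedSpace.exp (t • Mᵀ) * X * NormedSpace.exp (t • M)) i j)
      ((NormedSpace.exp (t • Mᵀ) * (Mᵀ * X + X * M) * NormedSpace.exp (t • M)) i j) t := fun t =>
    (Matrix.entryLinearMap ℝ ℝ i j).hasDerivAt_comp_matrix (hasDerivAt_exp_mul_mul_exp M X t)
  have hlim : Tendsto
      (fun t : ℝ => (NormedSpace.exp (t • Mᵀ) * X * NormedSpace.exp (t • M)) i j) atTop (𝓝 0) :=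
    ((continuous_id.matrix_elem i j).tendsto (0 : Matrix ι ι ℝ)).comp (hM.tendsto_exp_mul_mul_exp X)
  have := integral_Ioi_of_hasDerivAt_of_tendsto (hd 0).continuousAt.continuousWithinAt
    (fun t _ => hd t) (hM.integrableOn_exp_mul_mul_exp _ i j) hlim
  rw [lyapInt, Matrix.of_apply]
  refine this.trans ?_
  simp

theorem IsHurwitz.eq_lyapInt {M N X : Matrix ι ι ℝ} (hM : IsHurwitz M)
    (h : Mᵀ * X + X * M = -N) : X = lyapInt M N := by
  have := hM.lyapInt_lyapunov (-X)
  rw [neg_neg, mul_neg, neg_mul, ← neg_add, h, neg_neg] at this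
  exact this.symm

/-- The Lyapunov operator `X ↦ Mᵀ X + X M`. -/
def lyapOp (M : Matrix ι ι ℝ) : Matrix ι ι ℝ →ₗ[ℝ] Matrix ι ι ℝ :=
  LinearMap.mulLeft ℝ Mᵀ + LinearMap.mulRight ℝ M

theorem lyapOp_apply (M X : Matrix ι ι ℝ) : lyapOp M X = Mᵀ * X + X * M := rfl

theorem IsHurwitz.lyapOp_injective {M : Matrix ι ι ℝ} (hM : IsHurwitz M) :
    Function.Injective (lyapOp M) := fun X Y h => by
  have hX := hM.lyapInt_lyapunov X
  rw [← lyapOp_apply, h, lyapOp_apply, hM.lyapInt_lyapunov Y] at hX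
  exact (neg_injective hX).symm

/-- The Lyapunov operator is injective, because the integral inverts it from the left up to sign; in
finite dimension it is then surjective, and any solution must be the integral. -/
theorem IsHurwitz.lyapInt_spec {M : Matrix ι ι ℝ} (hM : IsHurwitz M) (N : Matrix ι ι ℝ) :
    Mᵀ * lyapInt M N + lyapInt M N * M = -N := by
  obtain ⟨X, hX⟩ := LinearMap.surjective_of_injective hM.lyapOp_injective (-N)
  rw [lyapOp_apply] at hX
  rwa [← hM.eq_lyapInt hX]

theorem IsHurwitz.posSemidef_lyapInt {M N : Matrix ι ι ℝ} (hM : IsHurwitz M) (hN : N.PosSemidef) :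
    (lyapInt M N).PosSemidef := by
  rw [Matrix.posSemidef_real_iff] at hN ⊢
  have hspec := hM.lyapInt_spec N
  set X := lyapInt M N with hX
  refine ⟨?_, fun x => ?_⟩
  · rw [hX]
    refine hM.eq_lyapInt ?_
    rw [← hX, ← hN.1, ← Matrix.transpose_neg, ← hspec]
    simp [add_comm]
  · have hd := fun t : ℝ =>
      (quadFormAt x).hasDerivAt_comp_matrix (hasDerivAt_exp_mul_mul_exp M X t)
    -- Along z(t) = exp(tM)x the form zᵀXz has derivative -zᵀNz ≤ 0 and tends to 0, so its value at
    -- t = 0 is nonnegative.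
    have hanti : Antitone fun t : ℝ => quadFormAt x (NormedSpace.exp (t • Mᵀ) * X *
        NormedSpace.exp (t • M)) := by
      refine antitone_of_deriv_nonpos (fun t => (hd t).differentiableAt) fun t => ?_
      rw [(hd t).deriv, hspec, quadFormAt_apply, mul_neg, neg_mul, Matrix.neg_mulVec,
        dotProduct_neg, neg_nonpos, ← Matrix.transpose_smul]
      have := hN.2 (NormedSpace.exp (t • M) *ᵥ x)
      rw [← Matrix.mulVec_mulVec, ← Matrix.mulVec_mulVec]
      refine this.trans_eq ?_
      rw [Matrix.dotProduct_mulVec x, ← Matrix.mulVec_transpose]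
      congr 2
      rw [← Matrix.transpose_transpose (NormedSpace.exp (t • M))]
      congr 1
      exact (Matrix.exp_transpose (t • M)).symm
    have hlim : Tendsto (fun t : ℝ => quadFormAt x (NormedSpace.exp (t • Mᵀ) * X *
        NormedSpace.exp (t • M))) atTop (𝓝 0) := by
      have hc : Continuous fun Z : Matrix ι ι ℝ => quadFormAt x Z :=
        continuous_const.dotProduct (continuous_id.matrix_mulVec continuous_const)
      have := (hc.tendsto 0).comp (hM.tendsto_exp_mul_mul_exp X)
      rwa [map_zero] at this
    simpa [quadFormAt_apply] using hanti.le_of_tendsto hlim 0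

theorem Matrix.PosSemidef.mulVec_eq_zero_of_dotProduct {X : Matrix ι ι ℝ} (hX : X.PosSemidef)
    {x : ι → ℝ} (h : x ⬝ᵥ (X *ᵥ x) = 0) : X *ᵥ x = 0 :=
  (hX.dotProduct_mulVec_zero_iff x).1 (by simpa using h)

theorem IsHurwitz.posDef_lyapInt {M N : Matrix ι ι ℝ} (hM : IsHurwitz M) (hN : N.PosDef) :
    (lyapInt M N).PosDef := by
  have hps := hM.posSemidef_lyapInt hN.posSemidef
  have h := Matrix.posSemidef_real_iff.1 hps
  refine Matrix.posDef_real_iff.2 ⟨h.1, fun x hx => (h.2 x).lt_of_ne fun h0 => ?_⟩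
  have hz := hps.mulVec_eq_zero_of_dotProduct h0.symm
  have h1 := congrArg (fun Z => x ⬝ᵥ (Z *ᵥ x)) (hM.lyapInt_spec N)
  simp only [Matrix.add_mulVec, ← Matrix.mulVec_mulVec, hz, Matrix.mulVec_zero, zero_add,
    Matrix.neg_mulVec, dotProduct_neg] at h1
  rw [Matrix.dotProduct_mulVec, ← Matrix.mulVec_transpose, h.1, hz, zero_dotProduct] at h1
  have := (Matrix.posDef_real_iff.1 hN).2 x hx
  linarith

theorem dotProduct_lyapunov_mulVec {M P : Matrix ι ι ℝ} (hP : Pᵀ = P) (x : ι → ℝ) :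
    x ⬝ᵥ ((Mᵀ * P + P * M) *ᵥ x) = 2 * ((M *ᵥ x) ⬝ᵥ (P *ᵥ x)) := by
  rw [Matrix.add_mulVec, dotProduct_add, ← Matrix.mulVec_mulVec, ← Matrix.mulVec_mulVec,
    Matrix.dotProduct_mulVec, Matrix.vecMul_transpose, Matrix.dotProduct_mulVec x P,
    ← Matrix.mulVec_transpose, hP, dotProduct_comm (P *ᵥ x)]
  ring

/-- The real form of `v* (Mᵀ P + P M) v = 2 Re z (v* P v)` for an eigenvector `v = x + i y`. -/
theorem dotProduct_lyapunov_eigen {M P : Matrix ι ι ℝ} (hP : Pᵀ = P) {a b : ℝ} {x y : ι → ℝ}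
    (hx : M *ᵥ x = a • x - b • y) (hy : M *ᵥ y = b • x + a • y) :
    x ⬝ᵥ ((Mᵀ * P + P * M) *ᵥ x) + y ⬝ᵥ ((Mᵀ * P + P * M) *ᵥ y) =
      2 * a * (x ⬝ᵥ (P *ᵥ x) + y ⬝ᵥ (P *ᵥ y)) := by
  rw [dotProduct_lyapunov_mulVec hP, dotProduct_lyapunov_mulVec hP, hx, hy]
  have : y ⬝ᵥ (P *ᵥ x) = x ⬝ᵥ (P *ᵥ y) := by
    rw [Matrix.dotProduct_mulVec, ← Matrix.mulVec_transpose, hP, dotProduct_comm]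
  simp only [sub_dotProduct, add_dotProduct, smul_dotProduct, smul_eq_mul, this]
  ring

/-- For an eigenvector v with eigenvalue z, 2 Re z · v*Pv = -v*Nv < 0. Semidefiniteness of P
suffices, since strictness comes from N. -/
theorem isHurwitz_of_lyapunov {M P N : Matrix ι ι ℝ} (hP : P.PosSemidef) (hN : N.PosDef)
    (h : Mᵀ * P + P * M = -N) : IsHurwitz M := by
  rw [Matrix.posSemidef_real_iff] at hP
  rw [Matrix.posDef_real_iff] at hN
  have hN' : ∀ x, 0 ≤ x ⬝ᵥ (N *ᵥ x) := fun x => by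
    by_cases hx : x = 0
    · simp [hx]
    · exact (hN.2 x hx).le
  refine isHurwitz_iff_real.2 fun a b x y ha hx hy => ?_
  have h1 := dotProduct_lyapunov_eigen hP.1 hx hy
  have h2 : 0 ≤ 2 * a * (x ⬝ᵥ (P *ᵥ x) + y ⬝ᵥ (P *ᵥ y)) :=
    mul_nonneg (by positivity) (add_nonneg (hP.2 x) (hP.2 y))
  rw [← h1, h, Matrix.neg_mulVec, Matrix.neg_mulVec, dotProduct_neg, dotProduct_neg] at h2
  have hx0 := hN' x
  have hy0 := hN' y
  constructor
  · by_contra hne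
    have := hN.2 x hne
    linarith
  · by_contra hne
    have := hN.2 y hne
    linarith

/-- The operators P ↦ MᵀP + PM and Y ↦ MY + YMᵀ are adjoint for the trace pairing. -/
theorem trace_lyapunov_duality {M P N Y W : Matrix ι ι ℝ} (hP : Mᵀ * P + P * M = -N)
    (hY : M * Y + Y * Mᵀ = -W) : (P * W).trace = (N * Y).trace := by
  have hN : N = -(Mᵀ * P + P * M) := by rw [hP, neg_neg]
  have hW : W = -(M * Y + Y * Mᵀ) := by rw [hY, neg_neg]
  rw [hN, hW, mul_neg, neg_mul, Matrix.trace_neg, Matrix.trace_neg, mul_add, add_mul,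
    Matrix.trace_add, Matrix.trace_add, ← mul_assoc, ← mul_assoc, Matrix.trace_mul_comm (P * Y) Mᵀ,
    ← mul_assoc, add_comm]

end Lyapunov

end

noncomputable section

set_option linter.unusedSectionVars false

/-! ### Frobenius norm, traces and positive semidefinite matrices -/

section Trace

variable {ι κ : Type*} [Fintype ι] [DecidableEq ι] [Fintype κ] [DecidableEq κ]

theorem Matrix.frobenius_norm_sq_eq_sum (X : Matrix κ ι ℝ) : ‖X‖ ^ 2 = ∑ i, ∑ j, X i j ^ 2 := by
  rw [Matrix.frobenius_norm_def, ← Real.sqrt_eq_rpow, Real.sq_sqrt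
    (Finset.sum_nonneg fun _ _ => Finset.sum_nonneg fun _ _ => by positivity)]
  simp

theorem Matrix.trace_mul_transpose_eq_sum (X Z : Matrix κ ι ℝ) :
    (X * Zᵀ).trace = ∑ i, ∑ j, X i j * Z i j := by
  simp [Matrix.trace, Matrix.mul_apply]

theorem Matrix.frobenius_norm_sq_eq_trace (X : Matrix κ ι ℝ) : ‖X‖ ^ 2 = (X * Xᵀ).trace := by
  rw [Matrix.frobenius_norm_sq_eq_sum, Matrix.trace_mul_transpose_eq_sum]
  simp [sq]

theorem Matrix.abs_trace_mul_transpose_le (X Z : Matrix κ ι ℝ) :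
    |(X * Zᵀ).trace| ≤ ‖X‖ * ‖Z‖ := by
  rw [← Real.sqrt_sq (norm_nonneg X), ← Real.sqrt_sq (norm_nonneg Z),
    ← Real.sqrt_mul (by positivity), Matrix.trace_mul_transpose_eq_sum,
    Matrix.frobenius_norm_sq_eq_sum, Matrix.frobenius_norm_sq_eq_sum]
  apply Real.abs_le_sqrt
  simp only [← Fintype.sum_prod_type']
  exact Finset.sum_mul_sq_le_sq_mul_sq _ _ _

open scoped MatrixOrder Matrix.Norms.L2Operator in
theorem Matrix.PosSemidef.exists_eq_transpose_mul_self {Y : Matrix ι ι ℝ} (hY : Y.PosSemidef) :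
    ∃ C : Matrix ι ι ℝ, Y = Cᵀ * C := by
  obtain ⟨C, hC⟩ := CStarAlgebra.nonneg_iff_eq_star_mul_self.mp hY.nonneg
  exact ⟨C, by simpa [Matrix.star_eq_conjTranspose] using hC⟩

theorem Matrix.PosSemidef.mul_mul_transpose {Y : Matrix ι ι ℝ} (hY : Y.PosSemidef)
    (X : Matrix κ ι ℝ) : (X * Y * Xᵀ).PosSemidef := by
  simpa using hY.mul_mul_conjTranspose_same X

theorem Matrix.PosSemidef.transpose_mul_mul {Y : Matrix ι ι ℝ} (hY : Y.PosSemidef)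
    (X : Matrix ι κ ℝ) : (Xᵀ * Y * X).PosSemidef := by
  simpa using hY.conjTranspose_mul_mul_same X

theorem Matrix.PosSemidef.trace_mul_nonneg {X Z : Matrix ι ι ℝ} (hX : X.PosSemidef)
    (hZ : Z.PosSemidef) : 0 ≤ (X * Z).trace := by
  obtain ⟨C, rfl⟩ := hZ.exists_eq_transpose_mul_self
  rw [← mul_assoc, Matrix.trace_mul_comm, ← mul_assoc]
  exact (hX.mul_mul_transpose C).trace_nonneg

theorem Matrix.PosSemidef.trace_mul_mul_transpose_le {Y : Matrix ι ι ℝ} (hY : Y.PosSemidef)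
    (X : Matrix κ ι ℝ) : (X * Y * Xᵀ).trace ≤ Y.trace * ‖X‖ ^ 2 := by
  obtain ⟨C, rfl⟩ := hY.exists_eq_transpose_mul_self
  have h1 : (X * (Cᵀ * C) * Xᵀ).trace = ‖X * Cᵀ‖ ^ 2 := by
    rw [Matrix.frobenius_norm_sq_eq_trace]
    simp [Matrix.mul_assoc]
  have h2 : (Cᵀ * C).trace = ‖C‖ ^ 2 := by
    rw [Matrix.frobenius_norm_sq_eq_trace, Matrix.trace_mul_comm]
  rw [h1, h2, ← mul_pow, mul_comm, ← Matrix.frobenius_norm_transpose C]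
  gcongr
  exact Matrix.frobenius_norm_mul _ _

theorem Matrix.PosSemidef.norm_le_trace {Y : Matrix ι ι ℝ} (hY : Y.PosSemidef) :
    ‖Y‖ ≤ Y.trace := by
  obtain ⟨C, rfl⟩ := hY.exists_eq_transpose_mul_self
  have h2 : (Cᵀ * C).trace = ‖C‖ ^ 2 := by
    rw [Matrix.frobenius_norm_sq_eq_trace, Matrix.trace_mul_comm]
  rw [h2, sq]
  refine (Matrix.frobenius_norm_mul _ _).trans_eq ?_
  rw [Matrix.frobenius_norm_transpose]

end Trace

/-! ### The smallest eigenvalue -/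

section LamMin

variable {ι κ : Type*} [Fintype ι] [DecidableEq ι] [Fintype κ] [DecidableEq κ]

theorem Matrix.IsHermitian.lamMin_mem_spectrum [Nonempty ι] {M : Matrix ι ι ℝ}
    (hM : M.IsHermitian) : lamMin M ∈ spectrum ℝ M :=
  Set.Nonempty.csInf_mem ⟨_, hM.eigenvalues_mem_spectrum_real (Classical.arbitrary ι)⟩
    M.finite_real_spectrum

theorem Matrix.IsHermitian.exists_mulVec_eq_lamMin [Nonempty ι] {M : Matrix ι ι ℝ}
    (hM : M.IsHermitian) : ∃ v, v ≠ 0 ∧ M *ᵥ v = lamMin M • v :=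
  (Matrix.mem_spectrum_iff_exists_mulVec _ _).1 hM.lamMin_mem_spectrum

theorem Matrix.IsHermitian.posSemidef_sub_lamMin {M : Matrix ι ι ℝ} (hM : M.IsHermitian) :
    (M - lamMin M • (1 : Matrix ι ι ℝ)).PosSemidef := by
  have h1 : (M - lamMin M • (1 : Matrix ι ι ℝ)).IsHermitian :=
    hM.sub (by simp [Matrix.IsHermitian])
  refine Matrix.posSemidef_iff_isHermitian_and_spectrum_nonneg.2 ⟨h1, fun z hz => ?_⟩
  obtain ⟨v, hv, hvz⟩ := (Matrix.mem_spectrum_iff_exists_mulVec _ _).1 hz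
  rw [Matrix.sub_mulVec, Matrix.smul_mulVec, Matrix.one_mulVec, sub_eq_iff_eq_add, ← add_smul] at hvz
  have : lamMin M ≤ z + lamMin M := csInf_le M.finite_real_spectrum.bddBelow
    ((Matrix.mem_spectrum_iff_exists_mulVec _ _).2 ⟨v, hv, hvz⟩)
  simpa using this

theorem Matrix.IsHermitian.lamMin_mul_dotProduct_le {M : Matrix ι ι ℝ} (hM : M.IsHermitian)
    (x : ι → ℝ) : lamMin M * (x ⬝ᵥ x) ≤ x ⬝ᵥ (M *ᵥ x) := by
  have := (Matrix.posSemidef_real_iff.1 hM.posSemidef_sub_lamMin).2 x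
  rw [Matrix.sub_mulVec, Matrix.smul_mulVec, Matrix.one_mulVec, dotProduct_sub, dotProduct_smul,
    smul_eq_mul] at this
  linarith

theorem Matrix.PosDef.lamMin_pos [Nonempty ι] {M : Matrix ι ι ℝ} (hM : M.PosDef) :
    0 < lamMin M := by
  obtain ⟨v, hv, h⟩ := hM.isHermitian.exists_mulVec_eq_lamMin
  have h1 := (Matrix.posDef_real_iff.1 hM).2 v hv
  rw [h, dotProduct_smul, smul_eq_mul] at h1
  exact pos_of_mul_pos_left h1 (by simpa using dotProduct_star_self_nonneg v)

theorem Matrix.IsHermitian.lamMin_mul_trace_le {M Z : Matrix ι ι ℝ} (hM : M.IsHermitian)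
    (hZ : Z.PosSemidef) : lamMin M * Z.trace ≤ (M * Z).trace := by
  have := hM.posSemidef_sub_lamMin.trace_mul_nonneg hZ
  rw [sub_mul, Matrix.trace_sub, smul_mul_assoc, one_mul, Matrix.trace_smul, smul_eq_mul] at this
  linarith

theorem Matrix.IsHermitian.lamMin_mul_norm_sq_le {Y : Matrix ι ι ℝ} (hY : Y.IsHermitian)
    (X : Matrix κ ι ℝ) : lamMin Y * ‖X‖ ^ 2 ≤ (X * Y * Xᵀ).trace := by
  have h := hY.lamMin_mul_trace_le (Matrix.PosSemidef.one.transpose_mul_mul X)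
  rw [Matrix.mul_one, Matrix.trace_mul_comm Xᵀ, ← Matrix.frobenius_norm_sq_eq_trace,
    ← Matrix.mul_assoc, Matrix.trace_mul_cycle] at h
  exact h

theorem Matrix.IsHermitian.lamMin_mul_norm_le {Y : Matrix ι ι ℝ} (hY : Y.IsHermitian)
    (X : Matrix κ ι ℝ) : lamMin Y * ‖X‖ ≤ ‖X * Y‖ := by
  rcases (norm_nonneg X).eq_or_lt with h0 | h0
  · rw [← h0, mul_zero]; exact norm_nonneg _
  · refine le_of_mul_le_mul_right ?_ h0
    calc lamMin Y * ‖X‖ * ‖X‖ = lamMin Y * ‖X‖ ^ 2 := by ring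
      _ ≤ (X * Y * Xᵀ).trace := hY.lamMin_mul_norm_sq_le X
      _ ≤ _ := (le_abs_self _).trans (Matrix.abs_trace_mul_transpose_le _ _)

theorem Matrix.PosSemidef.lamMin_nonneg {Y : Matrix ι ι ℝ} (hY : Y.PosSemidef) : 0 ≤ lamMin Y :=
  Real.sInf_nonneg fun _ hz => (Matrix.posSemidef_iff_isHermitian_and_spectrum_nonneg.1 hY).2 hz

end LamMin

end

noncomputable section

set_option linter.unusedSectionVars false

/-! ### Openness and smooth dependence -/

section Smooth

variable {ι κ l : Type*} [Fintype ι] [DecidableEq ι] [Fintype κ] [DecidableEq κ] [Fintype l]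
  [DecidableEq l]

theorem Matrix.abs_dotProduct_mulVec_le (Z : Matrix ι ι ℝ) (x : ι → ℝ) :
    |x ⬝ᵥ (Z *ᵥ x)| ≤ ‖Z‖ * (x ⬝ᵥ x) := by
  have h1 : x ⬝ᵥ (Z *ᵥ x) = (Z * (Matrix.vecMulVec x x)ᵀ).trace := by
    rw [Matrix.trace_mul_transpose_eq_sum]
    simp only [dotProduct, Matrix.mulVec, Matrix.vecMulVec_apply, Finset.mul_sum]
    exact Finset.sum_congr rfl fun i _ => Finset.sum_congr rfl fun j _ => by ring
  have h0 : 0 ≤ x ⬝ᵥ x := by simpa using dotProduct_star_self_nonneg x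
  have h2 : ‖Matrix.vecMulVec x x‖ = x ⬝ᵥ x := by
    rw [← Real.sqrt_sq (norm_nonneg _), ← Real.sqrt_sq h0, Matrix.frobenius_norm_sq_eq_sum]
    congr 1
    simp only [dotProduct, sq, Finset.sum_mul_sum, Matrix.vecMulVec_apply]
    exact Finset.sum_congr rfl fun i _ => Finset.sum_congr rfl fun j _ => by ring
  rw [h1, ← h2]
  exact Matrix.abs_trace_mul_transpose_le _ _

/-- The Lyapunov certificate P of M for N = 1 still certifies every nearby M', because M'ᵀP + PM'
stays within distance 1 of -1. -/
theorem isOpen_setOf_isHurwitz : IsOpen {M : Matrix ι ι ℝ | IsHurwitz M} := by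
  rw [isOpen_iff_mem_nhds]
  intro M (hM : IsHurwitz M)
  have hP := hM.posSemidef_lyapInt (Matrix.PosSemidef.one (n := ι) (R := ℝ))
  have hspec := hM.lyapInt_spec 1
  set P := lyapInt M 1
  have hPs := (Matrix.posSemidef_real_iff.1 hP).1
  have hcont : Continuous fun M' : Matrix ι ι ℝ => ‖M'ᵀ * P + P * M' + 1‖ := by
    refine Continuous.norm ?_
    exact (((continuous_id.matrix_transpose).matrix_mul continuous_const).add
      (continuous_const.matrix_mul continuous_id)).add continuous_const
  have h0 : ‖Mᵀ * P + P * M + 1‖ < 1 := by rw [hspec]; simp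
  filter_upwards [hcont.continuousAt.eventually_lt_const h0] with M' hM'
  refine isHurwitz_of_lyapunov (N := -(M'ᵀ * P + P * M')) hP
    (Matrix.posDef_real_iff.2 ⟨?_, fun x hx => ?_⟩) (neg_neg _).symm
  · simp [hPs, add_comm]
  · have hpos : 0 < x ⬝ᵥ x := by simpa using dotProduct_star_self_pos_iff.2 hx
    have h1 := (abs_le.1 (Matrix.abs_dotProduct_mulVec_le (M'ᵀ * P + P * M' + 1) x)).2
    rw [Matrix.add_mulVec, Matrix.one_mulVec, dotProduct_add] at h1
    rw [Matrix.neg_mulVec, dotProduct_neg]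
    nlinarith

theorem Matrix.isBoundedBilinearMap_mul :
    IsBoundedBilinearMap ℝ fun p : Matrix ι κ ℝ × Matrix κ l ℝ => p.1 * p.2 where
  add_left _ _ _ := Matrix.add_mul _ _ _
  smul_left _ _ _ := Matrix.smul_mul _ _ _
  add_right _ _ _ := Matrix.mul_add _ _ _
  smul_right _ _ _ := Matrix.mul_smul _ _ _
  bound := ⟨1, one_pos, fun X Y => by rw [one_mul]; exact Matrix.frobenius_norm_mul X Y⟩

variable {E : Type*} [NormedAddCommGroup E] [NormedSpace ℝ E] {k : WithTop ℕ∞}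

theorem ContDiffAt.matrix_mul {f : E → Matrix ι κ ℝ} {g : E → Matrix κ l ℝ} {x : E}
    (hf : ContDiffAt ℝ k f x) (hg : ContDiffAt ℝ k g x) :
    ContDiffAt ℝ k (fun y => f y * g y) x :=
  Matrix.isBoundedBilinearMap_mul.contDiff.contDiffAt.comp x (hf.prodMk hg)

theorem LinearMap.contDiffAt_comp_matrix {F : Type*} [NormedAddCommGroup F] [NormedSpace ℝ F]
    (g : Matrix ι κ ℝ →ₗ[ℝ] F) {f : E → Matrix ι κ ℝ} {x : E} (hf : ContDiffAt ℝ k f x) :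
    ContDiffAt ℝ k (fun y => g (f y)) x :=
  (LinearMap.toContinuousLinearMap g).contDiff.contDiffAt.comp x hf

theorem ContDiffAt.matrix_transpose {f : E → Matrix ι κ ℝ} {x : E} (hf : ContDiffAt ℝ k f x) :
    ContDiffAt ℝ k (fun y => (f y)ᵀ) x :=
  (Matrix.transposeLinearEquiv ι κ ℝ ℝ).toLinearMap.contDiffAt_comp_matrix hf

theorem contDiffAt_clm_of_forall_apply {F G : Type*} [NormedAddCommGroup F] [NormedSpace ℝ F]
    [FiniteDimensional ℝ F] [NormedAddCommGroup G] [NormedSpace ℝ G] {f : E → F →L[ℝ] G} {x : E}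
    (h : ∀ v, ContDiffAt ℝ k (fun y => f y v) x) : ContDiffAt ℝ k f x := by
  let e₁ : F ≃L[ℝ] (Fin (Module.finrank ℝ F) → ℝ) :=
    ContinuousLinearEquiv.ofFinrankEq (Module.finrank_fin_fun ℝ).symm
  let e₂ := (e₁.arrowCongr (1 : G ≃L[ℝ] G)).trans (ContinuousLinearEquiv.piRing (Fin _))
  rw [← Function.id_comp f, ← e₂.symm_comp_self]
  exact e₂.symm.contDiff.contDiffAt.comp x (contDiffAt_pi.2 fun i => h _)

/-- Near x₀ the solution is Φ(x)⁻¹ b(x), and inversion of operators is smooth. Applied to the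
Lyapunov operator, this avoids differentiating under the integral. -/
theorem contDiffAt_of_linear_eq {F : Type*} [NormedAddCommGroup F] [NormedSpace ℝ F]
    [FiniteDimensional ℝ F] {Φ : E → F →ₗ[ℝ] F} {b X : E → F} {x₀ : E}
    (hinj : ∀ᶠ x in 𝓝 x₀, Function.Injective (Φ x))
    (hΦ : ∀ v, ContDiffAt ℝ k (fun x => Φ x v) x₀) (hb : ContDiffAt ℝ k b x₀)
    (hX : ∀ᶠ x in 𝓝 x₀, Φ x (X x) = b x) : ContDiffAt ℝ k X x₀ := by
  have : CompleteSpace F := FiniteDimensional.complete ℝ F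
  have hinv : ∀ x, Function.Injective (Φ x) →
      ∃ e : F ≃L[ℝ] F, (e : F →L[ℝ] F) = LinearMap.toContinuousLinearMap (Φ x) := fun x hx =>
    ⟨(LinearEquiv.ofInjectiveEndo (Φ x) hx).toContinuousLinearEquiv, by ext v; rfl⟩
  have hΦ' : ContDiffAt ℝ k (fun x => LinearMap.toContinuousLinearMap (Φ x)) x₀ :=
    contDiffAt_clm_of_forall_apply hΦ
  obtain ⟨e, he⟩ := hinv x₀ hinj.self_of_nhds
  have h1 : ContDiffAt ℝ k (fun x =>
      ContinuousLinearMap.inverse (LinearMap.toContinuousLinearMap (Φ x)) (b x)) x₀ := by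
    refine ContDiffAt.clm_apply ?_ hb
    refine ContDiffAt.comp (g := ContinuousLinearMap.inverse) x₀ ?_ hΦ'
    rw [← he]
    exact contDiffAt_map_inverse e
  refine h1.congr_of_eventuallyEq ?_
  filter_upwards [hinj, hX] with x hx hxX
  obtain ⟨e, he⟩ := hinv x hx
  rw [← hxX, ← he, ContinuousLinearMap.inverse_equiv]
  have : Φ x (X x) = e (X x) := (congrArg (fun L : F →L[ℝ] F => L (X x)) he).symm
  rw [this]
  simp

theorem ContDiffAt.lyapInt {f g : E → Matrix ι ι ℝ} {x : E} (hf : ContDiffAt ℝ k f x)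
    (hg : ContDiffAt ℝ k g x) (hx : IsHurwitz (f x)) :
    ContDiffAt ℝ k (fun y => lyapInt (f y) (g y)) x := by
  have hev : ∀ᶠ y in 𝓝 x, IsHurwitz (f y) :=
    hf.continuousAt.eventually (isOpen_setOf_isHurwitz.mem_nhds hx)
  refine contDiffAt_of_linear_eq (Φ := fun y => lyapOp (f y)) (b := fun y => -g y)
    (hev.mono fun y hy => hy.lyapOp_injective) (fun X => ?_) hg.neg
    (hev.mono fun y hy => hy.lyapInt_spec _)
  exact (hf.matrix_transpose.matrix_mul contDiffAt_const).add (contDiffAt_const.matrix_mul hf)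

end Smooth

end

noncomputable section

set_option linter.unusedSectionVars false

/-! ### Cost differences and the gradient -/

namespace TrackingLQR

variable {n m : ℕ} (s : TrackingLQR n m)

/-- The state correlation matrix, the solution of `M Y + Y Mᵀ + W = 0`. -/
def gram (K : Matrix (Fin m) (Fin n ⊕ Fin n) ℝ) : Matrix (Fin n ⊕ Fin n) (Fin n ⊕ Fin n) ℝ :=
  lyapInt (s.closedLoop K)ᵀ s.W

/-- The matrix `R K - Bᵀ P(K)`, which vanishes exactly at critical gains. -/
def gap (K : Matrix (Fin m) (Fin n ⊕ Fin n) ℝ) : Matrix (Fin m) (Fin n ⊕ Fin n) ℝ :=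
  s.R * K - s.augBᵀ * s.valueMatrix K

/-- The running cost matrix `Q̂ + Kᵀ R K`. -/
def weight (K : Matrix (Fin m) (Fin n ⊕ Fin n) ℝ) : Matrix (Fin n ⊕ Fin n) (Fin n ⊕ Fin n) ℝ :=
  s.augQ + Kᵀ * s.R * K

variable {s}

theorem closedLoop_sub (K K' : Matrix (Fin m) (Fin n ⊕ Fin n) ℝ) :
    s.closedLoop K' = s.closedLoop K - s.augB * (K' - K) := by
  simp only [closedLoop, Matrix.mul_sub]
  abel

theorem posSemidef_augQ (hQ : s.Q.PosDef) : s.augQ.PosSemidef := by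
  have hQ' := Matrix.posSemidef_real_iff.1 hQ.posSemidef
  refine Matrix.posSemidef_real_iff.2 ⟨?_, fun x => ?_⟩
  · simp [augQ, Matrix.fromBlocks_transpose, hQ'.1]
  · obtain ⟨u, v, rfl⟩ : ∃ u v, x = Sum.elim u v := ⟨_, _, (Sum.elim_comp_inl_inr x).symm⟩
    rw [augQ, Matrix.fromBlocks_mulVec]
    simpa [Sum.elim_comp_inl_inr, sumElim_dotProduct_sumElim] using hQ'.2 u

theorem posSemidef_weight (hQ : s.Q.PosDef) (hR : s.R.PosDef)
    (K : Matrix (Fin m) (Fin n ⊕ Fin n) ℝ) : (s.weight K).PosSemidef :=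
  (posSemidef_augQ hQ).add (hR.posSemidef.transpose_mul_mul K)

section Stabilizing

variable {K K' : Matrix (Fin m) (Fin n ⊕ Fin n) ℝ}

theorem valueMatrix_spec (hK : K ∈ s.stabilizing) :
    (s.closedLoop K)ᵀ * s.valueMatrix K + s.valueMatrix K * s.closedLoop K = -s.weight K :=
  IsHurwitz.lyapInt_spec hK _

theorem posSemidef_valueMatrix (hQ : s.Q.PosDef) (hR : s.R.PosDef) (hK : K ∈ s.stabilizing) :
    (s.valueMatrix K).PosSemidef :=
  IsHurwitz.posSemidef_lyapInt hK (posSemidef_weight hQ hR K)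

theorem gram_spec (hK : K ∈ s.stabilizing) :
    s.closedLoop K * s.gram K + s.gram K * (s.closedLoop K)ᵀ = -s.W := by
  simpa [gram] using (IsHurwitz.transpose hK).lyapInt_spec s.W

theorem posDef_gram (hW : s.W.PosDef) (hK : K ∈ s.stabilizing) : (s.gram K).PosDef :=
  (IsHurwitz.transpose hK).posDef_lyapInt hW

theorem cost_eq_trace_gram (hK : K ∈ s.stabilizing) :
    s.cost K = (s.weight K * s.gram K).trace :=
  trace_lyapunov_duality (valueMatrix_spec hK) (gram_spec hK)

/-- P(K') - P(K) solves a Lyapunov equation for the closed loop of K' whose right-hand side is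
exactly quadratic in K' - K; pairing with W moves the correlation matrix of K' onto that side. -/
theorem cost_sub_cost (hQ : s.Q.PosDef) (hR : s.R.PosDef) (hK : K ∈ s.stabilizing)
    (hK' : K' ∈ s.stabilizing) :
    s.cost K' - s.cost K = (((K' - K)ᵀ * s.gap K + (s.gap K)ᵀ * (K' - K) +
      (K' - K)ᵀ * s.R * (K' - K)) * s.gram K').trace := by
  have hRs := (Matrix.posDef_real_iff.1 hR).1
  have hPs := (Matrix.posSemidef_real_iff.1 (posSemidef_valueMatrix hQ hR hK)).1
  rw [cost, cost, ← Matrix.trace_sub, ← Matrix.sub_mul]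
  refine trace_lyapunov_duality ?_ (gram_spec hK')
  have h1 := valueMatrix_spec hK
  have h2 := valueMatrix_spec hK'
  obtain ⟨H, rfl⟩ : ∃ H, K' = K + H := ⟨K' - K, by abel⟩
  have h3 := closedLoop_sub (s := s) K (K + H)
  rw [add_sub_cancel_left] at h3 ⊢
  have h4 : (s.closedLoop (K + H))ᵀ * (s.valueMatrix (K + H) - s.valueMatrix K) +
      (s.valueMatrix (K + H) - s.valueMatrix K) * s.closedLoop (K + H) =
      -s.weight (K + H) - ((s.closedLoop (K + H))ᵀ * s.valueMatrix K +
        s.valueMatrix K * s.closedLoop (K + H)) := by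
    rw [← h2]; noncomm_ring
  have h5 : (s.closedLoop (K + H))ᵀ * s.valueMatrix K + s.valueMatrix K * s.closedLoop (K + H) =
      -s.weight K - (Hᵀ * (s.augBᵀ * s.valueMatrix K) + s.valueMatrix K * s.augB * H) := by
    rw [← h1, h3, Matrix.transpose_sub, Matrix.transpose_mul, Matrix.sub_mul, Matrix.mul_sub,
      Matrix.mul_assoc, Matrix.mul_assoc]
    abel
  rw [h4, h5, gap, Matrix.transpose_sub, Matrix.transpose_mul, Matrix.transpose_mul, hRs, hPs,
    Matrix.transpose_transpose, weight, weight]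
  simp only [Matrix.transpose_add, Matrix.add_mul, Matrix.mul_add, Matrix.sub_mul, Matrix.mul_sub,
    Matrix.mul_assoc]
  abel

end Stabilizing

theorem contDiffAt_closedLoop {k : WithTop ℕ∞} (K : Matrix (Fin m) (Fin n ⊕ Fin n) ℝ) :
    ContDiffAt ℝ k s.closedLoop K :=
  (contDiffAt_const.sub (contDiffAt_const.matrix_mul contDiffAt_id)).sub contDiffAt_const

theorem isOpen_stabilizing : IsOpen s.stabilizing := by
  refine isOpen_setOf_isHurwitz.preimage (f := s.closedLoop) ?_
  exact continuous_iff_continuousAt.2 fun K => (contDiffAt_closedLoop (k := 0) K).continuousAt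

section Stabilizing

variable {K K' : Matrix (Fin m) (Fin n ⊕ Fin n) ℝ} {k : WithTop ℕ∞}

theorem contDiffAt_gram (hK : K ∈ s.stabilizing) : ContDiffAt ℝ k s.gram K :=
  (contDiffAt_closedLoop K).matrix_transpose.lyapInt contDiffAt_const (IsHurwitz.transpose hK)

theorem contDiffAt_valueMatrix (hK : K ∈ s.stabilizing) : ContDiffAt ℝ k s.valueMatrix K :=
  (contDiffAt_closedLoop K).lyapInt (contDiffAt_const.add
    ((contDiffAt_id.matrix_transpose.matrix_mul contDiffAt_const).matrix_mul contDiffAt_id)) hK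

theorem contDiffAt_gap (hK : K ∈ s.stabilizing) : ContDiffAt ℝ k s.gap K :=
  (contDiffAt_const.matrix_mul contDiffAt_id).sub
    (contDiffAt_const.matrix_mul (contDiffAt_valueMatrix hK))

theorem contDiffAt_cost (hK : K ∈ s.stabilizing) : ContDiffAt ℝ k s.cost K :=
  (Matrix.traceLinearMap _ ℝ ℝ).contDiffAt_comp_matrix
    ((contDiffAt_valueMatrix hK).matrix_mul contDiffAt_const)

theorem fderiv_cost_apply (hQ : s.Q.PosDef) (hR : s.R.PosDef) (hW : s.W.PosDef)
    (hK : K ∈ s.stabilizing) (H : Matrix (Fin m) (Fin n ⊕ Fin n) ℝ) :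
    fderiv ℝ s.cost K H = 2 * (s.gap K * s.gram K * Hᵀ).trace := by
  have hline : HasDerivAt (fun t : ℝ => K + t • H) H 0 := by
    have := ((hasDerivAt_id (0 : ℝ)).smul_const H).const_add K
    rwa [one_smul] at this
  have hd1 : HasDerivAt (fun t : ℝ => s.cost (K + t • H)) (fderiv ℝ s.cost K H) 0 := by
    have h0 : DifferentiableAt ℝ s.cost (K + (0 : ℝ) • H) := by
      rw [zero_smul, add_zero]
      exact (contDiffAt_cost (k := 1) hK).differentiableAt one_ne_zero
    have := h0.hasFDerivAt.comp_hasDerivAt (0 : ℝ) hline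
    rwa [zero_smul, add_zero] at this
  set q : ℝ → ℝ := fun t => ((Hᵀ * s.gap K + (s.gap K)ᵀ * H + t • (Hᵀ * s.R * H)) *
    s.gram (K + t • H)).trace with hq
  have hcont : ContinuousAt q 0 := by
    have h0 : ContinuousAt s.gram (K + (0 : ℝ) • H) := by
      rw [zero_smul, add_zero]
      exact (contDiffAt_gram (k := 0) hK).continuousAt
    have h1 : ContinuousAt (fun t : ℝ => s.gram (K + t • H)) 0 :=
      ContinuousAt.comp (f := fun t : ℝ => K + t • H) h0 hline.continuousAt
    have h2 : ContinuousAt (fun t : ℝ => Hᵀ * s.gap K + (s.gap K)ᵀ * H + t • (Hᵀ * s.R * H)) 0 :=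
      continuousAt_const.add (continuousAt_id.smul continuousAt_const)
    have h3 : Continuous fun p : Matrix (Fin n ⊕ Fin n) (Fin n ⊕ Fin n) ℝ ×
        Matrix (Fin n ⊕ Fin n) (Fin n ⊕ Fin n) ℝ => (p.1 * p.2).trace :=
      (continuous_fst.matrix_mul continuous_snd).matrix_trace
    exact ContinuousAt.comp (f := fun t : ℝ => (_, _)) h3.continuousAt (h2.prodMk h1)
  have hev : ∀ᶠ t in 𝓝 (0 : ℝ), K + t • H ∈ s.stabilizing := by
    refine hline.continuousAt.eventually ?_
    change ∀ᶠ K' in 𝓝 (K + (0 : ℝ) • H), K' ∈ s.stabilizing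
    rw [zero_smul, add_zero]
    exact isOpen_stabilizing.mem_nhds hK
  -- By the exact difference formula q is the difference quotient for small t ≠ 0, and it is
  -- continuous at 0.
  have hd2 : HasDerivAt (fun t : ℝ => s.cost (K + t • H)) (q 0) 0 := by
    rw [hasDerivAt_iff_tendsto_slope]
    refine (hcont.tendsto.mono_left nhdsWithin_le_nhds).congr' ?_
    filter_upwards [hev.filter_mono nhdsWithin_le_nhds, self_mem_nhdsWithin] with t ht ht0
    have ht0' : t ≠ 0 := ht0
    rw [slope_def_field, zero_smul, add_zero, cost_sub_cost hQ hR hK ht, add_sub_cancel_left,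
      sub_zero, eq_div_iff ht0', hq, mul_comm, ← smul_eq_mul, ← Matrix.trace_smul,
      ← Matrix.smul_mul]
    congr 2
    simp only [smul_add, Matrix.transpose_smul, Matrix.smul_mul, Matrix.mul_smul]
  rw [hd1.unique hd2, hq]
  have hYs := (Matrix.posDef_real_iff.1 (posDef_gram hW hK)).1
  simp only [zero_smul, add_zero, Matrix.add_mul, Matrix.trace_add]
  have e1 : (Hᵀ * s.gap K * s.gram K).trace = (s.gap K * s.gram K * Hᵀ).trace := by
    rw [Matrix.mul_assoc, Matrix.trace_mul_comm]
  have e2 : ((s.gap K)ᵀ * H * s.gram K).trace = (s.gap K * s.gram K * Hᵀ).trace := by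
    rw [← Matrix.trace_transpose, Matrix.transpose_mul, Matrix.transpose_mul,
      Matrix.transpose_transpose, hYs, Matrix.trace_mul_comm, Matrix.mul_assoc,
      Matrix.mul_assoc, Matrix.trace_mul_comm, Matrix.mul_assoc]
  rw [e1, e2]
  ring

theorem grad_eq (hQ : s.Q.PosDef) (hR : s.R.PosDef) (hW : s.W.PosDef) (hK : K ∈ s.stabilizing) :
    s.grad K = (2 : ℝ) • (s.gap K * s.gram K) := by
  ext i j
  rw [grad, matGrad, Matrix.of_apply, fderiv_cost_apply hQ hR hW hK,
    Matrix.trace_mul_transpose_eq_sum, Matrix.smul_apply, smul_eq_mul]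
  congr 1
  rw [Finset.sum_eq_single i, Finset.sum_eq_single j]
  · simp
  · intro b _ hb; simp [hb.symm]
  · simp
  · intro b _ hb; exact Finset.sum_eq_zero fun c _ => by simp [hb.symm]
  · simp

theorem fderiv_cost_eq_trace_grad (hQ : s.Q.PosDef) (hR : s.R.PosDef) (hW : s.W.PosDef)
    (hK : K ∈ s.stabilizing) (H : Matrix (Fin m) (Fin n ⊕ Fin n) ℝ) :
    fderiv ℝ s.cost K H = (s.grad K * Hᵀ).trace := by
  rw [fderiv_cost_apply hQ hR hW hK, grad_eq hQ hR hW hK, Matrix.smul_mul, Matrix.trace_smul,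
    smul_eq_mul]

theorem contDiffAt_grad (hQ : s.Q.PosDef) (hR : s.R.PosDef) (hW : s.W.PosDef)
    (hK : K ∈ s.stabilizing) : ContDiffAt ℝ k s.grad K := by
  refine ContDiffAt.congr_of_eventuallyEq
    (((contDiffAt_gap hK).matrix_mul (contDiffAt_gram hK)).const_smul (2 : ℝ)) ?_
  filter_upwards [isOpen_stabilizing.mem_nhds hK] with K' hK'
  exact grad_eq hQ hR hW hK'

end Stabilizing

end TrackingLQR

end

noncomputable section

set_option linter.unusedSectionVars false

/-! ### Bounds on sublevel sets and compactness -/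

namespace TrackingLQR

variable {n m : ℕ} {s : TrackingLQR n m} {K K' K₀ : Matrix (Fin m) (Fin n ⊕ Fin n) ℝ}

theorem _root_.Matrix.trace_eq_toBlocks (Y : Matrix (Fin n ⊕ Fin n) (Fin n ⊕ Fin n) ℝ) :
    Y.trace = Y.toBlocks₁₁.trace + Y.toBlocks₂₂.trace := by
  simp [Matrix.trace, Matrix.toBlocks₁₁, Matrix.toBlocks₂₂]

theorem trace_augQ_mul (Y : Matrix (Fin n ⊕ Fin n) (Fin n ⊕ Fin n) ℝ) :
    (s.augQ * Y).trace = (s.Q * Y.toBlocks₁₁).trace := by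
  conv_lhs => rw [← Matrix.fromBlocks_toBlocks Y]
  rw [augQ, Matrix.fromBlocks_multiply, Matrix.trace_eq_toBlocks]
  simp

theorem trace_weight_mul (K : Matrix (Fin m) (Fin n ⊕ Fin n) ℝ)
    (Y : Matrix (Fin n ⊕ Fin n) (Fin n ⊕ Fin n) ℝ) :
    (s.weight K * Y).trace = (s.Q * Y.toBlocks₁₁).trace + (s.R * (K * Y * Kᵀ)).trace := by
  rw [weight, Matrix.add_mul, Matrix.trace_add, trace_augQ_mul, Matrix.mul_assoc,
    Matrix.mul_assoc, Matrix.trace_mul_comm Kᵀ, Matrix.mul_assoc, Matrix.mul_assoc]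

theorem _root_.Matrix.PosSemidef.toBlocks₁₁ {Y : Matrix (Fin n ⊕ Fin n) (Fin n ⊕ Fin n) ℝ}
    (hY : Y.PosSemidef) : Y.toBlocks₁₁.PosSemidef := hY.submatrix Sum.inl

theorem _root_.Matrix.PosSemidef.toBlocks₂₂ {Y : Matrix (Fin n ⊕ Fin n) (Fin n ⊕ Fin n) ℝ}
    (hY : Y.PosSemidef) : Y.toBlocks₂₂.PosSemidef := hY.submatrix Sum.inr

theorem lamMin_Q_mul_trace_le (hQ : s.Q.PosDef) (hR : s.R.PosDef) (hW : s.W.PosDef)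
    (hK : K ∈ s.stabilizing) : lamMin s.Q * (s.gram K).toBlocks₁₁.trace ≤ s.cost K := by
  have hY := (posDef_gram hW hK).posSemidef
  rw [cost_eq_trace_gram hK, trace_weight_mul]
  have h1 := hQ.isHermitian.lamMin_mul_trace_le hY.toBlocks₁₁
  have h2 := hR.posSemidef.trace_mul_nonneg (hY.mul_mul_transpose K)
  linarith

theorem lamMin_R_mul_norm_sq_le [NeZero m] (hQ : s.Q.PosDef) (hR : s.R.PosDef) (hW : s.W.PosDef)
    (hK : K ∈ s.stabilizing) : lamMin s.R * (lamMin (s.gram K) * ‖K‖ ^ 2) ≤ s.cost K := by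
  have hY := (posDef_gram hW hK).posSemidef
  rw [cost_eq_trace_gram hK, trace_weight_mul]
  have h1 := hQ.posSemidef.trace_mul_nonneg hY.toBlocks₁₁
  have h2 := hR.isHermitian.lamMin_mul_trace_le (hY.mul_mul_transpose K)
  have h3 := hY.isHermitian.lamMin_mul_norm_sq_le K
  nlinarith [hR.lamMin_pos]

theorem cost_nonneg (hQ : s.Q.PosDef) (hR : s.R.PosDef) (hW : s.W.PosDef)
    (hK : K ∈ s.stabilizing) : 0 ≤ s.cost K :=
  (posSemidef_valueMatrix hQ hR hK).trace_mul_nonneg hW.posSemidef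

/-- The shifted leader dynamics, the lower diagonal block of every closed-loop matrix. -/
def leader (s : TrackingLQR n m) : Matrix (Fin n) (Fin n) ℝ :=
  s.D - (s.γ / 2) • (1 : Matrix (Fin n) (Fin n) ℝ)

theorem closedLoop_eq_fromBlocks (K : Matrix (Fin m) (Fin n ⊕ Fin n) ℝ) :
    s.closedLoop K = Matrix.fromBlocks (s.A - s.B * K.toCols₁ - (s.γ / 2) • 1)
      (s.A + s.C - s.D - s.B * K.toCols₂) 0 s.leader := by
  conv_lhs => rw [closedLoop, ← Matrix.fromCols_toCols K, augB, augA,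
    Matrix.fromRows_mul_fromCols, ← Matrix.fromBlocks_one, Matrix.fromBlocks_smul,
    sub_eq_add_neg, sub_eq_add_neg, Matrix.fromBlocks_neg, Matrix.fromBlocks_neg,
    Matrix.fromBlocks_add, Matrix.fromBlocks_add]
  simp [leader, sub_eq_add_neg]

theorem leader_spec (hK : K ∈ s.stabilizing) :
    s.leader * (s.gram K).toBlocks₂₂ + (s.gram K).toBlocks₂₂ * s.leaderᵀ = -s.W.toBlocks₂₂ := by
  have h := gram_spec hK
  rw [← Matrix.fromBlocks_toBlocks (s.gram K), closedLoop_eq_fromBlocks,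
    Matrix.fromBlocks_transpose, Matrix.fromBlocks_multiply, Matrix.fromBlocks_multiply,
    Matrix.fromBlocks_add] at h
  have := congrArg Matrix.toBlocks₂₂ h
  rw [Matrix.toBlocks_fromBlocks₂₂] at this
  simp only [Matrix.zero_mul, zero_add, Matrix.transpose_zero, Matrix.mul_zero] at this
  exact this

/-- The lower right block of the equation for Y(K) is a Lyapunov equation for the leader alone, with
a positive definite right-hand side up to sign. -/
theorem isHurwitz_leader (hW : s.W.PosDef) (hK : K ∈ s.stabilizing) : IsHurwitz s.leader := by
  have h : IsHurwitz s.leaderᵀ := by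
    refine isHurwitz_of_lyapunov (posDef_gram hW hK).posSemidef.toBlocks₂₂
      (hW.submatrix Sum.inr_injective) ?_
    rw [Matrix.transpose_transpose]
    exact leader_spec hK
  simpa using h.transpose

theorem toBlocks₂₂_gram (hW : s.W.PosDef) (hK : K ∈ s.stabilizing) :
    (s.gram K).toBlocks₂₂ = lyapInt s.leaderᵀ s.W.toBlocks₂₂ := by
  refine (isHurwitz_leader hW hK).transpose.eq_lyapInt ?_
  rw [Matrix.transpose_transpose]
  exact leader_spec hK

/-- Bound on the closed-loop matrices over a sublevel set, as it enters the convergence rate. -/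
def driftBound (s : TrackingLQR n m) (c : ℝ) : ℝ :=
  ‖s.augA‖ + s.γ * n / 2 + ‖s.augB‖ ^ 2 * c / (lamMin s.W * lamMin s.R)

theorem driftBound_pos [NeZero n] [NeZero m] (hR : s.R.PosDef) (hγ : 0 < s.γ) (hW : s.W.PosDef)
    {c : ℝ} (hc : 0 ≤ c) : 0 < s.driftBound c := by
  have h1 := hR.lamMin_pos
  have h2 := hW.lamMin_pos
  have h3 : (0 : ℝ) < n := by exact_mod_cast Nat.pos_of_ne_zero (NeZero.ne n)
  rw [driftBound]
  positivity

/-- Testing the equation for Y(K) on an eigenvector of its smallest eigenvalue ℓ bounds λmin(W) by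
2ℓ times the size of the closed loop. That size contains ‖K‖, which the cost controls only through
λmin(R) ℓ ‖K‖² ≤ c. -/
theorem lamMin_W_le [NeZero n] [NeZero m] (hQ : s.Q.PosDef) (hR : s.R.PosDef) (hγ : 0 < s.γ)
    (hW : s.W.PosDef) (hK : K ∈ s.stabilizing) {c : ℝ} (hc : s.cost K ≤ c) :
    lamMin s.W ≤ 4 * lamMin (s.gram K) * s.driftBound c := by
  have hY := posDef_gram hW hK
  have hℓ := hY.lamMin_pos
  have hlW := hW.lamMin_pos
  have hlR := hR.lamMin_pos
  have hkey := (lamMin_R_mul_norm_sq_le hQ hR hW hK).trans hc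
  obtain ⟨v, hv, hYv⟩ := hY.isHermitian.exists_mulVec_eq_lamMin
  set ℓ := lamMin (s.gram K)
  set k := ‖K‖
  set b := ‖s.augB‖ with hb
  have hvv : 0 < v ⬝ᵥ v := by simpa using dotProduct_star_self_pos_iff.2 hv
  have hn1 : (1 : ℝ) ≤ n := by exact_mod_cast Nat.one_le_iff_ne_zero.2 (NeZero.ne n)
  have h1 : v ⬝ᵥ (s.W *ᵥ v) = -(2 * ℓ * (v ⬝ᵥ (s.closedLoop K *ᵥ v))) := by
    have h := dotProduct_lyapunov_mulVec (M := (s.closedLoop K)ᵀ)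
      (Matrix.posDef_real_iff.1 hY).1 v
    rw [Matrix.transpose_transpose, gram_spec hK, Matrix.neg_mulVec, dotProduct_neg, hYv,
      Matrix.mulVec_transpose, dotProduct_smul, ← Matrix.dotProduct_mulVec, smul_eq_mul] at h
    linarith
  have h2 : -(v ⬝ᵥ (s.closedLoop K *ᵥ v)) ≤ (‖s.augA‖ + b * k + s.γ / 2) * (v ⬝ᵥ v) := by
    have e1 := (abs_le.1 (Matrix.abs_dotProduct_mulVec_le s.augA v)).1
    have e2 := (abs_le.1 (Matrix.abs_dotProduct_mulVec_le (s.augB * K) v)).2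
    have e3 : ‖s.augB * K‖ ≤ b * k := Matrix.frobenius_norm_mul _ _
    rw [closedLoop, Matrix.sub_mulVec, Matrix.sub_mulVec, Matrix.smul_mulVec, Matrix.one_mulVec,
      dotProduct_sub, dotProduct_sub, dotProduct_smul, smul_eq_mul]
    nlinarith
  have h3 := hW.isHermitian.lamMin_mul_dotProduct_le v
  have h4 : lamMin s.W ≤ 2 * ℓ * (‖s.augA‖ + b * k + s.γ / 2) := by
    refine le_of_mul_le_mul_right ?_ hvv
    nlinarith
  -- The arithmetic-geometric inequality trades the term linear in ‖K‖ for ℓ‖K‖². Absorbing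
  -- λmin(W)/2 on the left turns the factor 2 into 4.
  have h5 : 2 * ℓ * (b * k) ≤ lamMin s.W / 2 + 2 * ℓ * (b ^ 2 * c / (lamMin s.W * lamMin s.R)) := by
    have e1 : 2 * ℓ * (b * k) ≤ lamMin s.W / 2 + 2 * ℓ * (b ^ 2 * (ℓ * k ^ 2) / lamMin s.W) := by
      have : lamMin s.W / 2 + 2 * ℓ * (b ^ 2 * (ℓ * k ^ 2) / lamMin s.W) - 2 * ℓ * (b * k) =
          (lamMin s.W - 2 * ℓ * b * k) ^ 2 / (2 * lamMin s.W) := by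
        field_simp
        ring
      have h0 : 0 ≤ (lamMin s.W - 2 * ℓ * b * k) ^ 2 / (2 * lamMin s.W) := by positivity
      linarith
    have e2 : b ^ 2 * (ℓ * k ^ 2) / lamMin s.W ≤ b ^ 2 * c / (lamMin s.W * lamMin s.R) := by
      rw [div_le_div_iff₀ hlW (by positivity)]
      have := mul_le_mul_of_nonneg_left hkey (by positivity : 0 ≤ b ^ 2 * lamMin s.W)
      linarith
    have := mul_le_mul_of_nonneg_left e2 (by positivity : 0 ≤ 2 * ℓ)
    linarith
  have h6 : s.γ / 2 ≤ s.γ * n / 2 := by nlinarith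
  have h7 := mul_le_mul_of_nonneg_left h6 (by positivity : 0 ≤ 2 * ℓ)
  rw [driftBound, ← hb]
  nlinarith

theorem exists_bound_on_sublevel [NeZero n] [NeZero m] (hQ : s.Q.PosDef) (hR : s.R.PosDef)
    (hγ : 0 < s.γ) (hW : s.W.PosDef) (hK₀ : K₀ ∈ s.stabilizing) :
    ∃ C : ℝ, ∀ K ∈ s.sublevel K₀, ‖K‖ ≤ C ∧ ‖s.gram K‖ ≤ C := by
  have hc := cost_nonneg hQ hR hW hK₀
  set c := s.cost K₀
  have hd := driftBound_pos hR hγ hW hc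
  have hlW := hW.lamMin_pos
  have hlR := hR.lamMin_pos
  have hlQ := hQ.lamMin_pos
  refine ⟨max √(4 * s.driftBound c * c / (lamMin s.R * lamMin s.W))
    (c / lamMin s.Q + (lyapInt s.leaderᵀ s.W.toBlocks₂₂).trace), fun K hK => ⟨?_, ?_⟩⟩
  · refine le_max_of_le_left (Real.le_sqrt_of_sq_le ?_)
    have h1 := lamMin_W_le hQ hR hγ hW hK.1 hK.2
    have h2 := (lamMin_R_mul_norm_sq_le hQ hR hW hK.1).trans hK.2
    rw [le_div_iff₀ (by positivity)]
    calc ‖K‖ ^ 2 * (lamMin s.R * lamMin s.W)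
        ≤ ‖K‖ ^ 2 * (lamMin s.R * (4 * lamMin (s.gram K) * s.driftBound c)) := by gcongr
      _ = 4 * s.driftBound c * (lamMin s.R * (lamMin (s.gram K) * ‖K‖ ^ 2)) := by ring
      _ ≤ _ := by gcongr
  · refine le_max_of_le_right ?_
    have h1 := (lamMin_Q_mul_trace_le hQ hR hW hK.1).trans hK.2
    refine (posDef_gram hW hK.1).posSemidef.norm_le_trace.trans ?_
    rw [Matrix.trace_eq_toBlocks, toBlocks₂₂_gram hW hK.1]
    gcongr
    rw [le_div_iff₀ hlQ]
    linarith

/-- The sublevel set is the projection of a set of pairs (K, Y) cut out by closed conditions.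
Stability need not be imposed: Y ⪰ 0 with the Lyapunov equation for W > 0 forces it, so limits
cannot escape the stabilizing set. -/
theorem isCompact_sublevel [NeZero n] [NeZero m] (hQ : s.Q.PosDef) (hR : s.R.PosDef)
    (hγ : 0 < s.γ) (hW : s.W.PosDef) (hK₀ : K₀ ∈ s.stabilizing) :
    IsCompact (s.sublevel K₀) := by
  obtain ⟨C, hC⟩ := exists_bound_on_sublevel hQ hR hγ hW hK₀
  set T : Set (Matrix (Fin m) (Fin n ⊕ Fin n) ℝ × Matrix (Fin n ⊕ Fin n) (Fin n ⊕ Fin n) ℝ) :=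
    {p | (p.2ᵀ = p.2 ∧ ∀ x, 0 ≤ x ⬝ᵥ (p.2 *ᵥ x)) ∧
      s.closedLoop p.1 * p.2 + p.2 * (s.closedLoop p.1)ᵀ = -s.W ∧
      (s.weight p.1 * p.2).trace ≤ s.cost K₀} with hT
  have hTspec : ∀ p ∈ T, p.1 ∈ s.sublevel K₀ ∧ p.2 = s.gram p.1 := by
    rintro ⟨K, Y⟩ ⟨hY, hL, hc⟩
    have hL' : (s.closedLoop K)ᵀᵀ * Y + Y * (s.closedLoop K)ᵀ = -s.W := by
      rwa [Matrix.transpose_transpose]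
    have hH : IsHurwitz (s.closedLoop K)ᵀ :=
      isHurwitz_of_lyapunov (Matrix.posSemidef_real_iff.2 hY) hW hL'
    have hK : K ∈ s.stabilizing := by simpa [stabilizing] using hH.transpose
    have hYK : Y = s.gram K := hH.eq_lyapInt hL'
    refine ⟨⟨hK, ?_⟩, hYK⟩
    rw [cost_eq_trace_gram hK, ← hYK]
    exact hc
  have himage : Prod.fst '' T = s.sublevel K₀ := by
    ext K
    constructor
    · rintro ⟨p, hp, rfl⟩
      exact (hTspec p hp).1
    · intro hK
      refine ⟨(K, s.gram K), ⟨Matrix.posSemidef_real_iff.1 (posDef_gram hW hK.1).posSemidef,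
        gram_spec hK.1, ?_⟩, rfl⟩
      rw [← cost_eq_trace_gram hK.1]
      exact hK.2
  have hcl : Continuous fun p : Matrix (Fin m) (Fin n ⊕ Fin n) ℝ ×
      Matrix (Fin n ⊕ Fin n) (Fin n ⊕ Fin n) ℝ => s.closedLoop p.1 := by
    have : Continuous s.closedLoop :=
      continuous_iff_continuousAt.2 fun K => (contDiffAt_closedLoop (k := 0) K).continuousAt
    exact this.comp continuous_fst
  have hclosed : IsClosed T := by
    refine IsClosed.inter (IsClosed.inter ?_ ?_) (IsClosed.inter ?_ ?_)
    · exact isClosed_eq continuous_snd.matrix_transpose continuous_snd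
    · have hall : IsClosed {p : Matrix (Fin m) (Fin n ⊕ Fin n) ℝ ×
          Matrix (Fin n ⊕ Fin n) (Fin n ⊕ Fin n) ℝ | ∀ x, 0 ≤ x ⬝ᵥ (p.2 *ᵥ x)} := by
        rw [Set.ofPred_forall]
        exact isClosed_iInter fun x => isClosed_le continuous_const
          (continuous_const.dotProduct (continuous_snd.matrix_mulVec continuous_const))
      exact hall
    · exact isClosed_eq ((hcl.matrix_mul continuous_snd).add
        (continuous_snd.matrix_mul hcl.matrix_transpose)) continuous_const
    · refine isClosed_le (Continuous.matrix_trace (Continuous.matrix_mul ?_ continuous_snd))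
        continuous_const
      exact continuous_const.add ((continuous_fst.matrix_transpose.matrix_mul
        continuous_const).matrix_mul continuous_fst)
  have hbdd : T ⊆ Metric.closedBall (0 : Matrix (Fin m) (Fin n ⊕ Fin n) ℝ) C ×ˢ
      Metric.closedBall (0 : Matrix (Fin n ⊕ Fin n) (Fin n ⊕ Fin n) ℝ) C := by
    rintro p hp
    obtain ⟨h1, h2⟩ := hTspec p hp
    obtain ⟨h3, h4⟩ := hC _ h1
    rw [← h2] at h4
    exact ⟨mem_closedBall_zero_iff.2 h3, mem_closedBall_zero_iff.2 h4⟩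
  rw [← himage]
  refine IsCompact.image ?_ continuous_fst
  exact IsCompact.of_isClosed_subset
    ((isCompact_closedBall _ C).prod (isCompact_closedBall _ C)) hclosed hbdd

end TrackingLQR

end

noncomputable section

set_option linter.unusedSectionVars false

/-! ### The Riccati equation, the optimal gain and gradient dominance -/

namespace TrackingLQR

variable {n m : ℕ} {s : TrackingLQR n m} {K K' K₀ : Matrix (Fin m) (Fin n ⊕ Fin n) ℝ}
  {P : Matrix (Fin n ⊕ Fin n) (Fin n ⊕ Fin n) ℝ}

theorem quadratic_le_cost_sub [NeZero m] (hQ : s.Q.PosDef) (hR : s.R.PosDef) (hW : s.W.PosDef)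
    (hK : K ∈ s.stabilizing) (hK' : K' ∈ s.stabilizing) :
    2 * (s.gap K * s.gram K' * (K' - K)ᵀ).trace +
      lamMin s.R * ((K' - K) * s.gram K' * (K' - K)ᵀ).trace ≤ s.cost K' - s.cost K := by
  have hY := posDef_gram hW hK'
  have hYs := (Matrix.posDef_real_iff.1 hY).1
  rw [cost_sub_cost hQ hR hK hK']
  generalize s.gram K' = Y at hY hYs ⊢
  generalize K' - K = H
  have e1 : (Hᵀ * s.gap K * Y).trace = (s.gap K * Y * Hᵀ).trace := by
    rw [Matrix.mul_assoc, Matrix.trace_mul_comm]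
  have e2 : ((s.gap K)ᵀ * H * Y).trace = (s.gap K * Y * Hᵀ).trace := by
    rw [← Matrix.trace_transpose, Matrix.transpose_mul, Matrix.transpose_mul,
      Matrix.transpose_transpose, hYs, Matrix.trace_mul_comm, Matrix.mul_assoc,
      Matrix.mul_assoc, Matrix.trace_mul_comm, Matrix.mul_assoc]
  have e3 : (Hᵀ * s.R * H * Y).trace = (s.R * (H * Y * Hᵀ)).trace := by
    rw [Matrix.mul_assoc, Matrix.mul_assoc, Matrix.trace_mul_comm, Matrix.mul_assoc]
  have e4 := hR.isHermitian.lamMin_mul_trace_le (hY.posSemidef.mul_mul_transpose H)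
  rw [Matrix.add_mul, Matrix.add_mul, Matrix.trace_add, Matrix.trace_add, e1, e2, e3]
  linarith

theorem cost_lt_of_gap_eq_zero [NeZero n] [NeZero m] (hQ : s.Q.PosDef) (hR : s.R.PosDef)
    (hW : s.W.PosDef) (hK : K ∈ s.stabilizing) (hgap : s.gap K = 0) (hK' : K' ∈ s.stabilizing)
    (hne : K' ≠ K) : s.cost K < s.cost K' := by
  have h1 := quadratic_le_cost_sub hQ hR hW hK hK'
  have hY := posDef_gram hW hK'
  have h2 := hY.isHermitian.lamMin_mul_norm_sq_le (K' - K)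
  have h3 : 0 < ‖K' - K‖ := norm_pos_iff.2 (sub_ne_zero.2 hne)
  have h4 := hY.lamMin_pos
  have h5 := hR.lamMin_pos
  have h6 : 0 < lamMin s.R * ((K' - K) * s.gram K' * (K' - K)ᵀ).trace :=
    mul_pos h5 (lt_of_lt_of_le (by positivity) h2)
  rw [hgap] at h1
  simp only [Matrix.zero_mul, Matrix.trace_zero, mul_zero, zero_add] at h1
  linarith

theorem gap_eq_zero_of_grad_eq_zero [NeZero n] (hQ : s.Q.PosDef) (hR : s.R.PosDef)
    (hW : s.W.PosDef) (hK : K ∈ s.stabilizing) (h : s.grad K = 0) : s.gap K = 0 := by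
  rw [grad_eq hQ hR hW hK, smul_eq_zero] at h
  have h1 := (posDef_gram hW hK).isHermitian.lamMin_mul_norm_le (s.gap K)
  rw [h.resolve_left two_ne_zero, norm_zero] at h1
  have h2 := (posDef_gram hW hK).lamMin_pos
  exact norm_le_zero_iff.1 (nonpos_of_mul_nonpos_right h1 h2)

theorem exists_gap_eq_zero [NeZero n] [NeZero m] (hQ : s.Q.PosDef) (hR : s.R.PosDef)
    (hγ : 0 < s.γ) (hW : s.W.PosDef) (hK₀ : K₀ ∈ s.stabilizing) :
    ∃ K ∈ s.stabilizing, s.gap K = 0 := by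
  have hcont : ContinuousOn s.cost (s.sublevel K₀) := fun K hK =>
    (contDiffAt_cost (k := 0) hK.1).continuousAt.continuousWithinAt
  obtain ⟨K, hK, hmin⟩ := (isCompact_sublevel hQ hR hγ hW hK₀).exists_isMinOn
    ⟨K₀, hK₀, le_rfl⟩ hcont
  have hmin' : ∀ K' ∈ s.stabilizing, s.cost K ≤ s.cost K' := fun K' hK' => by
    rcases le_total (s.cost K') (s.cost K₀) with h | h
    · exact hmin ⟨hK', h⟩
    · exact hK.2.trans h
  have hloc : IsLocalMin s.cost K := by
    filter_upwards [isOpen_stabilizing.mem_nhds hK.1] with K' hK'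
    exact hmin' K' hK'
  refine ⟨K, hK.1, gap_eq_zero_of_grad_eq_zero hQ hR hW hK.1 ?_⟩
  have : fderiv ℝ s.cost K = 0 := hloc.fderiv_eq_zero
  ext i j
  rw [grad, matGrad, Matrix.of_apply, this]
  rfl

/-- Under this relation P𝓑R⁻¹𝓑ᵀP, P𝓑K and KᵀRK all coincide, so the two equations differ only by
regrouping. -/
theorem riccati_iff (hR : s.R.PosDef) (hP : Pᵀ = P) (hK : s.R * K = s.augBᵀ * P) :
    s.Riccati P ↔ (s.closedLoop K)ᵀ * P + P * s.closedLoop K = -s.weight K := by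
  have hRs := (Matrix.posDef_real_iff.1 hR).1
  have hdet : IsUnit s.R.det := (Matrix.isUnit_iff_isUnit_det _).1 hR.isUnit
  have h1 : s.R⁻¹ * (s.augBᵀ * P) = K := by
    rw [← hK, ← Matrix.mul_assoc, Matrix.nonsing_inv_mul _ hdet, Matrix.one_mul]
  have h2 : P * s.augB * s.R⁻¹ * s.augBᵀ * P = P * s.augB * K := by
    rw [Matrix.mul_assoc, Matrix.mul_assoc, h1]
  have h3 : Kᵀ * s.R = P * s.augB := by
    rw [← hRs, ← Matrix.transpose_mul, hK, Matrix.transpose_mul, hP, Matrix.transpose_transpose]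
  have h4 : Kᵀ * s.augBᵀ * P = P * s.augB * K := by
    rw [Matrix.mul_assoc, ← hK, ← Matrix.mul_assoc, h3]
  have h5 : (s.closedLoop K)ᵀ * P + P * s.closedLoop K = P * s.augA + s.augAᵀ * P - s.γ • P -
      P * s.augB * K - P * s.augB * K := by
    rw [closedLoop]
    simp only [Matrix.transpose_sub, Matrix.transpose_mul, Matrix.transpose_smul,
      Matrix.transpose_one, Matrix.sub_mul, Matrix.mul_sub, h4, Matrix.smul_mul, Matrix.mul_smul,
      Matrix.one_mul, Matrix.mul_one, ← Matrix.mul_assoc]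
    have : s.γ • P = (s.γ / 2) • P + (s.γ / 2) • P := by rw [← add_smul, add_halves]
    rw [this]
    abel
  rw [Riccati, h2, h5, weight, h3, eq_neg_iff_add_eq_zero]
  constructor <;> intro h <;> rw [← h] <;> abel

theorem mul_eq_of_gap_eq_zero (h : s.gap K = 0) : s.R * K = s.augBᵀ * s.valueMatrix K :=
  sub_eq_zero.1 h

/-- An eigenvector with Re z ≥ 0 has zero running cost, so Q > 0 kills its tracking-error component.
What remains is an eigenvector of the leader, which is Hurwitz because some stabilizing gain exists.
-/
theorem mem_stabilizing_of_riccati (hQ : s.Q.PosDef) (hR : s.R.PosDef) (hW : s.W.PosDef)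
    (hK₀ : K₀ ∈ s.stabilizing) (hP : P.PosSemidef) (hK : s.R * K = s.augBᵀ * P)
    (hric : s.Riccati P) : K ∈ s.stabilizing := by
  have hP' := Matrix.posSemidef_real_iff.1 hP
  have hlyap := (riccati_iff hR hP'.1 hK).1 hric
  have hN := Matrix.posSemidef_real_iff.1 (posSemidef_weight hQ hR K)
  refine isHurwitz_iff_real.2 fun a b x y ha hx hy => ?_
  have h1 := dotProduct_lyapunov_eigen hP'.1 hx hy
  have h2 : 0 ≤ 2 * a * (x ⬝ᵥ (P *ᵥ x) + y ⬝ᵥ (P *ᵥ y)) :=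
    mul_nonneg (by positivity) (add_nonneg (hP'.2 x) (hP'.2 y))
  rw [← h1, hlyap, Matrix.neg_mulVec, Matrix.neg_mulVec, dotProduct_neg, dotProduct_neg] at h2
  have hzero : ∀ u v : Fin n → ℝ, Sum.elim u v ⬝ᵥ (s.weight K *ᵥ Sum.elim u v) ≤ 0 → u = 0 := by
    intro u v h
    by_contra hu
    have hq := (Matrix.posDef_real_iff.1 hQ).2 u hu
    have hr := (Matrix.posSemidef_real_iff.1 (hR.posSemidef.transpose_mul_mul K)).2 (Sum.elim u v)
    rw [weight, Matrix.add_mulVec, dotProduct_add, augQ, Matrix.fromBlocks_mulVec] at h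
    simp only [Sum.elim_comp_inl, Sum.elim_comp_inr, Matrix.zero_mulVec, add_zero,
      sumElim_dotProduct_sumElim, dotProduct_zero] at h
    linarith
  obtain ⟨x₁, x₂, rfl⟩ : ∃ u v, x = Sum.elim u v := ⟨_, _, (Sum.elim_comp_inl_inr x).symm⟩
  obtain ⟨y₁, y₂, rfl⟩ : ∃ u v, y = Sum.elim u v := ⟨_, _, (Sum.elim_comp_inl_inr y).symm⟩
  obtain rfl := hzero x₁ x₂ (by linarith [hN.2 (Sum.elim y₁ y₂)])
  obtain rfl := hzero y₁ y₂ (by linarith [hN.2 (Sum.elim 0 x₂)])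
  rw [closedLoop_eq_fromBlocks, Matrix.fromBlocks_mulVec] at hx hy
  have hx2 : s.leader *ᵥ x₂ = a • x₂ - b • y₂ := by
    funext i
    simpa using congrFun hx (Sum.inr i)
  have hy2 : s.leader *ᵥ y₂ = b • x₂ + a • y₂ := by
    funext i
    simpa using congrFun hy (Sum.inr i)
  obtain ⟨rfl, rfl⟩ := isHurwitz_iff_real.1 (isHurwitz_leader hW hK₀) a b x₂ y₂ ha hx2 hy2
  simp [Sum.elim_zero_zero]

theorem eq_valueMatrix_of_riccati (hQ : s.Q.PosDef) (hR : s.R.PosDef) (hW : s.W.PosDef)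
    (hK₀ : K₀ ∈ s.stabilizing) (hP : P.PosSemidef) (hK : s.R * K = s.augBᵀ * P)
    (hric : s.Riccati P) : P = s.valueMatrix K :=
  IsHurwitz.eq_lyapInt (mem_stabilizing_of_riccati hQ hR hW hK₀ hP hK hric)
    ((riccati_iff hR (Matrix.posSemidef_real_iff.1 hP).1 hK).1 hric)

/-- Both gains are stabilizing with vanishing gap; were they different, each would have strictly
smaller cost than the other. -/
theorem riccati_unique [NeZero n] [NeZero m] (hQ : s.Q.PosDef) (hR : s.R.PosDef)
    (hW : s.W.PosDef) (hK : K ∈ s.stabilizing) (hgap : s.gap K = 0) (hP : P.PosSemidef)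
    (hric : s.Riccati P) : P = s.valueMatrix K := by
  have hdet : IsUnit s.R.det := (Matrix.isUnit_iff_isUnit_det _).1 hR.isUnit
  set K' := s.R⁻¹ * (s.augBᵀ * P)
  have hRK : s.R * K' = s.augBᵀ * P := by
    rw [← Matrix.mul_assoc, Matrix.mul_nonsing_inv _ hdet, Matrix.one_mul]
  have hK' := mem_stabilizing_of_riccati hQ hR hW hK hP hRK hric
  have hPK' := eq_valueMatrix_of_riccati hQ hR hW hK hP hRK hric
  have hgap' : s.gap K' = 0 := by rw [gap, ← hPK', hRK, sub_self]
  have : K' = K := by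
    by_contra hne
    exact lt_asymm (cost_lt_of_gap_eq_zero hQ hR hW hK hgap hK' hne)
      (cost_lt_of_gap_eq_zero hQ hR hW hK' hgap' hK (Ne.symm hne))
  rw [hPK', this]

theorem lamMin_R_mul_cost_sub_le [NeZero m] (hQ : s.Q.PosDef) (hR : s.R.PosDef)
    (hW : s.W.PosDef) (hK : K ∈ s.stabilizing) (hK' : K' ∈ s.stabilizing) :
    lamMin s.R * (s.cost K - s.cost K') ≤ (s.gap K * s.gram K' * (s.gap K)ᵀ).trace := by
  have h1 := quadratic_le_cost_sub hQ hR hW hK hK'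
  have hY := posDef_gram hW hK'
  have hYs := (Matrix.posDef_real_iff.1 hY).1
  have hr := hR.lamMin_pos
  generalize s.gram K' = Y at h1 hY hYs ⊢
  generalize s.gap K = F at h1 ⊢
  generalize K' - K = H at h1
  -- Completing the square in H removes the dependence on the step.
  have h2 := (hY.posSemidef.mul_mul_transpose (lamMin s.R • H + F)).trace_nonneg
  have e : (H * Y * Fᵀ).trace = (F * Y * Hᵀ).trace := by
    rw [← Matrix.trace_transpose, Matrix.transpose_mul, Matrix.transpose_mul, hYs,
      Matrix.transpose_transpose, Matrix.mul_assoc]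
  simp only [Matrix.transpose_add, Matrix.transpose_smul, Matrix.add_mul, Matrix.mul_add,
    Matrix.smul_mul, Matrix.mul_smul, Matrix.trace_add, Matrix.trace_smul, smul_eq_mul, e] at h2
  nlinarith

/-! ### Block estimates for positive semidefinite matrices -/

section Blocks

variable {Y : Matrix (Fin n ⊕ Fin n) (Fin n ⊕ Fin n) ℝ}

theorem trace_mul_mul_transpose_blocks (X Z : Matrix (Fin m) (Fin n ⊕ Fin n) ℝ) :
    (X * Y * Zᵀ).trace =
      (X.toCols₁ * Y.toBlocks₁₁ * Z.toCols₁ᵀ).trace + (X.toCols₂ * Y.toBlocks₂₁ * Z.toCols₁ᵀ).trace +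
      ((X.toCols₁ * Y.toBlocks₁₂ * Z.toCols₂ᵀ).trace +
        (X.toCols₂ * Y.toBlocks₂₂ * Z.toCols₂ᵀ).trace) := by
  conv_lhs => rw [← Matrix.fromCols_toCols X, ← Matrix.fromCols_toCols Z,
    ← Matrix.fromBlocks_toBlocks Y, Matrix.fromCols_mul_fromBlocks, Matrix.transpose_fromCols,
    Matrix.fromCols_mul_fromRows]
  simp only [Matrix.add_mul, Matrix.trace_add]

theorem norm_sq_toCols (X : Matrix (Fin m) (Fin n ⊕ Fin n) ℝ) :
    ‖X‖ ^ 2 = ‖X.toCols₁‖ ^ 2 + ‖X.toCols₂‖ ^ 2 := by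
  simp only [Matrix.frobenius_norm_sq_eq_sum, Fintype.sum_sum_type, Finset.sum_add_distrib]
  rfl

/-- Pairing XY with the reflection J = (-X₁, X₂) cancels the off-diagonal terms, and ‖J‖ = ‖X‖. The
result is linear in ‖XY‖, with no need to bound the lower right block of Y. -/
theorem trace_toCols₂_le (hY : Y.PosSemidef) (X : Matrix (Fin m) (Fin n ⊕ Fin n) ℝ) :
    (X.toCols₂ * Y.toBlocks₂₂ * X.toCols₂ᵀ).trace ≤
      ‖X * Y‖ * ‖X‖ + (X.toCols₁ * Y.toBlocks₁₁ * X.toCols₁ᵀ).trace := by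
  have hYs := (Matrix.posSemidef_real_iff.1 hY).1
  set J : Matrix (Fin m) (Fin n ⊕ Fin n) ℝ := Matrix.fromCols (-X.toCols₁) X.toCols₂ with hJ
  have h1 : ‖J‖ = ‖X‖ := by
    rw [← sq_eq_sq₀ (norm_nonneg _) (norm_nonneg _), norm_sq_toCols, norm_sq_toCols X, hJ]
    simp
  have h2 := (le_abs_self _).trans (Matrix.abs_trace_mul_transpose_le (X * Y) J)
  rw [trace_mul_mul_transpose_blocks, h1] at h2
  have h3 : (X.toCols₂ * Y.toBlocks₂₁ * X.toCols₁ᵀ).trace =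
      (X.toCols₁ * Y.toBlocks₁₂ * X.toCols₂ᵀ).trace := by
    have : Y.toBlocks₂₁ = Y.toBlocks₁₂ᵀ := by
      conv_lhs => rw [← hYs]
      rfl
    rw [this, ← Matrix.trace_transpose, Matrix.transpose_mul, Matrix.transpose_mul,
      Matrix.transpose_transpose, Matrix.transpose_transpose, Matrix.mul_assoc]
  simp only [hJ, Matrix.toCols₁_fromCols, Matrix.toCols₂_fromCols, Matrix.transpose_neg,
    Matrix.mul_neg, Matrix.trace_neg, h3] at h2
  linarith

theorem trace_le_two_mul_diag (hY : Y.PosSemidef) (X : Matrix (Fin m) (Fin n ⊕ Fin n) ℝ) :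
    (X * Y * Xᵀ).trace ≤ 2 * (X.toCols₁ * Y.toBlocks₁₁ * X.toCols₁ᵀ).trace +
      2 * (X.toCols₂ * Y.toBlocks₂₂ * X.toCols₂ᵀ).trace := by
  have h := (hY.mul_mul_transpose
    (Matrix.fromCols (-X.toCols₁) X.toCols₂ : Matrix (Fin m) (Fin n ⊕ Fin n) ℝ)).trace_nonneg
  rw [trace_mul_mul_transpose_blocks] at h ⊢
  simp only [Matrix.toCols₁_fromCols, Matrix.toCols₂_fromCols, Matrix.transpose_neg,
    Matrix.mul_neg, Matrix.neg_mul, neg_neg, Matrix.trace_neg] at h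
  linarith

theorem lamMin_le_trace_toBlocks₁₁ [NeZero n] (hY : Y.PosSemidef) :
    lamMin Y ≤ Y.toBlocks₁₁.trace := by
  have h := hY.isHermitian.posSemidef_sub_lamMin.toBlocks₁₁.trace_nonneg
  have e : (Y - lamMin Y • (1 : Matrix (Fin n ⊕ Fin n) (Fin n ⊕ Fin n) ℝ)).toBlocks₁₁.trace =
      Y.toBlocks₁₁.trace - n * lamMin Y := by
    simp [Matrix.trace, Matrix.toBlocks₁₁]
  rw [e] at h
  have hn1 : (1 : ℝ) ≤ n := by exact_mod_cast Nat.one_le_iff_ne_zero.2 (NeZero.ne n)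
  nlinarith [hY.lamMin_nonneg]

end Blocks

/-! ### The explicit gradient dominance constant -/

theorem cost_pos [NeZero n] (hQ : s.Q.PosDef) (hR : s.R.PosDef) (hW : s.W.PosDef)
    (hK : K ∈ s.stabilizing) : 0 < s.cost K := by
  have h1 := lamMin_le_trace_toBlocks₁₁ (posDef_gram hW hK).posSemidef
  have h2 := (posDef_gram hW hK).lamMin_pos
  exact (mul_pos hQ.lamMin_pos (h2.trans_le h1)).trans_le (lamMin_Q_mul_trace_le hQ hR hW hK)

theorem rate_eq (K₀ : Matrix (Fin m) (Fin n ⊕ Fin n) ℝ) :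
    s.rate K₀ = lamMin s.R * lamMin s.W ^ 2 * lamMin s.Q /
      (48 * s.cost K₀ * s.driftBound (s.cost K₀) ^ 2) := rfl

theorem rate_pos [NeZero n] [NeZero m] (hQ : s.Q.PosDef) (hR : s.R.PosDef) (hγ : 0 < s.γ)
    (hW : s.W.PosDef) (hK₀ : K₀ ∈ s.stabilizing) : 0 < s.rate K₀ := by
  have h1 := cost_pos hQ hR hW hK₀
  have h2 := driftBound_pos hR hγ hW h1.le
  have h3 := hR.lamMin_pos
  have h4 := hW.lamMin_pos
  have h5 := hQ.lamMin_pos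
  rw [rate_eq]
  positivity

/-- The completed square involves Y(K'), the gradient Y(K). Reducing to diagonal blocks, the upper
left ones have trace at most c/λmin(Q) and the lower right ones are equal, so the latter can be
estimated by ‖F Y(K)‖. -/
theorem lamMin_gram_sq_mul_cost_sub_le [NeZero n] [NeZero m] (hQ : s.Q.PosDef) (hR : s.R.PosDef)
    (hW : s.W.PosDef) (hK : K ∈ s.stabilizing) (hK' : K' ∈ s.stabilizing) {c : ℝ}
    (hc : s.cost K ≤ c) (hc' : s.cost K' ≤ c) :
    lamMin (s.gram K) ^ 2 * (lamMin s.R * (s.cost K - s.cost K')) ≤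
      6 * (c / lamMin s.Q) * ‖s.gap K * s.gram K‖ ^ 2 := by
  have hlQ := hQ.lamMin_pos
  have hY := posDef_gram hW hK
  have hY' := posDef_gram hW hK'
  have hℓ := hY.lamMin_pos
  have ht : (s.gram K).toBlocks₁₁.trace ≤ c / lamMin s.Q := by
    rw [le_div_iff₀ hlQ, mul_comm]
    exact (lamMin_Q_mul_trace_le hQ hR hW hK).trans hc
  have ht' : (s.gram K').toBlocks₁₁.trace ≤ c / lamMin s.Q := by
    rw [le_div_iff₀ hlQ, mul_comm]
    exact (lamMin_Q_mul_trace_le hQ hR hW hK').trans hc'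
  have hℓt := (lamMin_le_trace_toBlocks₁₁ hY.posSemidef).trans ht
  have hg := hY.isHermitian.lamMin_mul_norm_le (s.gap K)
  have h1 := trace_le_two_mul_diag hY'.posSemidef (s.gap K)
  have h2 := trace_toCols₂_le hY.posSemidef (s.gap K)
  -- The exchange of Y(K) for Y(K') in the block that no gain can influence.
  rw [toBlocks₂₂_gram hW hK, ← toBlocks₂₂_gram hW hK'] at h2
  have h3 := hY.posSemidef.toBlocks₁₁.trace_mul_mul_transpose_le (s.gap K).toCols₁
  have h3' := hY'.posSemidef.toBlocks₁₁.trace_mul_mul_transpose_le (s.gap K).toCols₁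
  have h4 : ‖(s.gap K).toCols₁‖ ^ 2 ≤ ‖s.gap K‖ ^ 2 := by
    rw [norm_sq_toCols (s.gap K)]
    linarith [sq_nonneg ‖(s.gap K).toCols₂‖]
  have hkey := lamMin_R_mul_cost_sub_le hQ hR hW hK hK'
  set ℓ := lamMin (s.gram K)
  set T := c / lamMin s.Q
  set g := ‖s.gap K * s.gram K‖
  set e := ‖s.gap K‖
  have hT0 : 0 < T := hℓ.trans_le hℓt
  have hg0 : 0 ≤ g := norm_nonneg _
  have he0 : 0 ≤ e := norm_nonneg _
  have h5 : (s.gap K * s.gram K' * (s.gap K)ᵀ).trace ≤ 4 * T * e ^ 2 + 2 * (g * e) := by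
    have a1 := mul_le_mul ht h4 (sq_nonneg _) hT0.le
    have a2 := mul_le_mul ht' h4 (sq_nonneg _) hT0.le
    linarith
  have a1 : (ℓ * e) ^ 2 ≤ g ^ 2 := by gcongr
  have a2 : ℓ * (g * (ℓ * e)) ≤ T * (g * g) := by gcongr
  calc _ ≤ ℓ ^ 2 * (4 * T * e ^ 2 + 2 * (g * e)) := by gcongr; exact hkey.trans h5
    _ = 4 * T * (ℓ * e) ^ 2 + 2 * (ℓ * (g * (ℓ * e))) := by ring
    _ ≤ 4 * T * g ^ 2 + 2 * (T * (g * g)) := by gcongr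
    _ = _ := by ring

theorem three_mul_rate_mul_le [NeZero n] [NeZero m] (hQ : s.Q.PosDef) (hR : s.R.PosDef)
    (hγ : 0 < s.γ) (hW : s.W.PosDef) (hK₀ : K₀ ∈ s.stabilizing) (hK : K ∈ s.sublevel K₀) :
    3 * s.rate K₀ * (s.cost K₀ / lamMin s.Q) ≤ lamMin s.R * lamMin (s.gram K) ^ 2 := by
  have hc := cost_pos hQ hR hW hK₀
  have hd := driftBound_pos hR hγ hW hc.le
  have hlR := hR.lamMin_pos
  have hlW := hW.lamMin_pos
  have hlQ := hQ.lamMin_pos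
  have hℓd := lamMin_W_le hQ hR hγ hW hK.1 hK.2
  -- The constant 48 is 3 · 4²: the 3 comes from 6 in the block estimate against ‖∇f‖² = 4‖FY‖², the
  -- 4 from the lower bound on λmin(Y(K)).
  have h : 3 * s.rate K₀ * (s.cost K₀ / lamMin s.Q) =
      lamMin s.R * (lamMin s.W / (4 * s.driftBound (s.cost K₀))) ^ 2 := by
    rw [rate_eq]
    field_simp
    norm_num
  rw [h]
  gcongr
  rw [div_le_iff₀ (by positivity)]
  linarith

theorem plOn_rate [NeZero n] [NeZero m] (hQ : s.Q.PosDef) (hR : s.R.PosDef) (hγ : 0 < s.γ)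
    (hW : s.W.PosDef) (hK₀ : K₀ ∈ s.stabilizing) (hK' : K' ∈ s.sublevel K₀) :
    s.PLOn (s.rate K₀) (s.sublevel K₀) K' := by
  intro K hK
  have hgrad : ‖s.grad K‖ ^ 2 = 4 * ‖s.gap K * s.gram K‖ ^ 2 := by
    rw [grad_eq hQ hR hW hK.1, norm_smul, mul_pow]
    norm_num
  have hT : 0 < s.cost K₀ / lamMin s.Q := div_pos (cost_pos hQ hR hW hK₀) hQ.lamMin_pos
  have h6 := lamMin_gram_sq_mul_cost_sub_le hQ hR hW hK.1 hK'.1 hK.2 hK'.2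
  have h7 := three_mul_rate_mul_le hQ hR hγ hW hK₀ hK
  have hrate := rate_pos hQ hR hγ hW hK₀
  rw [hgrad]
  rcases le_total (s.cost K - s.cost K') 0 with hneg | hpos
  · exact (mul_nonpos_of_nonneg_of_nonpos (by positivity) hneg).trans (by positivity)
  · refine le_of_mul_le_mul_left ?_ hT
    generalize s.cost K - s.cost K' = δ at *
    generalize s.cost K₀ / lamMin s.Q = T at *
    calc T * (2 * s.rate K₀ * δ) = 2 / 3 * ((3 * s.rate K₀ * T) * δ) := by ring
      _ ≤ 2 / 3 * ((lamMin s.R * lamMin (s.gram K) ^ 2) * δ) := by gcongr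
      _ = 2 / 3 * (lamMin (s.gram K) ^ 2 * (lamMin s.R * δ)) := by ring
      _ ≤ 2 / 3 * (6 * T * ‖s.gap K * s.gram K‖ ^ 2) := by gcongr
      _ = _ := by ring

end TrackingLQR

end

noncomputable section

/-! ### Global solutions of autonomous equations -/

section GlobalFlow

variable {E : Type*} [NormedAddCommGroup E] [NormedSpace ℝ E]

theorem exists_forall_hasDerivWithinAt_Ici_of_lipschitzWith [CompleteSpace E] {F : E → E}
    {L B : NNReal} (hL : LipschitzWith L F) (hB : ∀ x, ‖F x‖ ≤ B) (t₀ : ℝ) (x₀ : E) :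
    ∃ γ : ℝ → E, γ t₀ = x₀ ∧ ∀ t, t₀ ≤ t → HasDerivWithinAt γ (F (γ t)) (Ici t₀) t := by
  have hloc : ∀ N : ℕ, ∃ α : ℝ → E, α t₀ = x₀ ∧
      ∀ t ∈ Icc t₀ (t₀ + N), HasDerivWithinAt α (F (α t)) (Icc t₀ (t₀ + N)) t := by
    intro N
    have hPL : IsPicardLindelof (fun _ => F)
        -- Since the bounds on F are global, the ball may have radius B·N, as far as a solution can
        -- travel in time N.
        (⟨t₀, left_mem_Icc.2 (by simp)⟩ : Icc t₀ (t₀ + N)) x₀ (B * N) 0 B L :=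
      { lipschitzOnWith := fun _ _ => hL.lipschitzOnWith
        continuousOn := fun _ _ => continuousOn_const
        norm_le := fun _ _ x _ => hB x
        mul_max_le := by simp }
    exact hPL.exists_eq_forall_mem_Icc_hasDerivWithinAt₀
  choose α hα0 hα using hloc
  have hnhds : ∀ N t, t ∈ Ico t₀ (t₀ + (N : ℕ)) → Icc t₀ (t₀ + N) ∈ 𝓝[Ici t₀] t := fun N t ht => by
    rw [← Ici_inter_Iic]
    exact inter_mem self_mem_nhdsWithin (mem_nhdsWithin_of_mem_nhds (Iic_mem_nhds ht.2))
  have hIci : ∀ N t, t ∈ Ico t₀ (t₀ + (N : ℕ)) → HasDerivWithinAt (α N) (F (α N t)) (Ici t₀) t :=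
    fun N t ht => (hα N t (Ico_subset_Icc_self ht)).mono_of_mem_nhdsWithin
      (hnhds N t ht)
  have huniq : ∀ N M : ℕ, N ≤ M → EqOn (α N) (α M) (Icc t₀ (t₀ + N)) := by
    intro N M hNM
    have hNM' : (N : ℝ) ≤ M := by exact_mod_cast hNM
    have hsub : Icc t₀ (t₀ + N) ⊆ Icc t₀ (t₀ + M) := Icc_subset_Icc_right (by linarith)
    refine ODE_solution_unique_of_mem_Icc_right (v := fun _ => F) (s := fun _ => univ) (K := L)
      (fun _ _ => hL.lipschitzOnWith) (fun t ht => (hα N t ht).continuousWithinAt)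
      (fun t ht => (hIci N t ht).mono (Ici_subset_Ici.2 ht.1)) (fun _ _ => mem_univ _)
      (fun t ht => ((hα M t (hsub ht)).continuousWithinAt).mono hsub)
      (fun t ht => (hIci M t ⟨ht.1, by linarith [ht.2]⟩).mono (Ici_subset_Ici.2 ht.1))
      (fun _ _ => mem_univ _) ((hα0 N).trans (hα0 M).symm)
  set γ : ℝ → E := fun t => α (⌊t - t₀⌋₊ + 1) t with hγ
  have hγα : ∀ M : ℕ, EqOn γ (α M) (Icc t₀ (t₀ + M)) := by
    intro M t ht
    have h1 : t - t₀ < ⌊t - t₀⌋₊ + 1 := Nat.lt_floor_add_one _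
    rcases le_total (⌊t - t₀⌋₊ + 1) M with h | h
    · refine huniq _ M h ⟨ht.1, ?_⟩
      push_cast
      linarith
    · exact (huniq M _ h ht).symm
  refine ⟨γ, (hγα 0 (by simp)).trans (hα0 0), fun t ht => ?_⟩
  set N := ⌊t - t₀⌋₊ + 1 with hN
  have htN : t ∈ Ico t₀ (t₀ + (N : ℕ)) := by
    have h1 : t - t₀ < ⌊t - t₀⌋₊ + 1 := Nat.lt_floor_add_one _
    refine ⟨ht, ?_⟩
    rw [hN]
    push_cast
    linarith
  have h2 : γ =ᶠ[𝓝[Ici t₀] t] α N :=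
    Filter.eventuallyEq_of_mem (hnhds N t htN) (hγα N)
  exact (hIci N t htN).congr_of_eventuallyEq h2 rfl

theorem exists_cutoff_lipschitz [FiniteDimensional ℝ E] {S C : Set E} {g : E → E}
    (hS : IsOpen S) (hC : IsCompact C) (hCS : C ⊆ S) (hg : ∀ x ∈ S, ContDiffAt ℝ 1 g x) :
    ∃ χ : E → ℝ, (∀ x, 0 ≤ χ x) ∧ (∀ x ∈ C, χ x = 1) ∧
      ∃ L B : NNReal, LipschitzWith L (fun x => -(χ x • g x)) ∧ ∀ x, ‖-(χ x • g x)‖ ≤ B := by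
  have : ProperSpace E := FiniteDimensional.proper ℝ E
  obtain ⟨δ, hδ, hδS⟩ := hC.exists_cthickening_subset_open hS hCS
  set D := Metric.cthickening δ C
  have hD : IsCompact D := hC.cthickening
  have hlip : LocallyLipschitzOn D g := fun x hx => by
    obtain ⟨K, t, ht, hK⟩ := (hg x (hδS hx)).exists_lipschitzOnWith
    exact ⟨K, t, mem_nhdsWithin_of_mem_nhds ht, hK⟩
  obtain ⟨L, hL⟩ := hlip.exists_lipschitzOnWith_of_compact hD
  obtain ⟨G', hG'⟩ := hD.exists_bound_of_continuousOn hL.continuousOn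
  obtain ⟨G, hG⟩ : ∃ G : NNReal, ∀ x ∈ D, ‖g x‖ ≤ G :=
    ⟨G'.toNNReal, fun x hx => (hG' x hx).trans (Real.le_coe_toNNReal G')⟩
  set χ : E → ℝ := fun x => (thickenedIndicator hδ C x : ℝ) with hχ
  have hχ0 : ∀ x, 0 ≤ χ x := fun x => NNReal.coe_nonneg _
  have hχ1 : ∀ x, χ x ≤ 1 := fun x => by exact_mod_cast thickenedIndicator_le_one hδ C x
  have hχC : ∀ x ∈ C, χ x = 1 := fun x hx => by
    rw [hχ]; simp [thickenedIndicator_one hδ C hx]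
  have hχD : ∀ x, x ∉ D → χ x = 0 := fun x hx => by
    have h : x ∉ Metric.thickening δ C := fun h => hx (Metric.thickening_subset_cthickening _ _ h)
    rw [hχ]; simp [thickenedIndicator_zero hδ C h]
  set c := δ.toNNReal⁻¹
  have hχL : ∀ x y, |χ x - χ y| ≤ c * dist x y := fun x y => by
    have h := (lipschitzWith_thickenedIndicator hδ C).dist_le_mul x y
    rwa [NNReal.dist_eq] at h
  refine ⟨χ, hχ0, hχC, L + c * G, G, LipschitzWith.of_dist_le_mul fun x y => ?_, fun x => ?_⟩
  · rw [dist_neg_neg, dist_eq_norm]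
    push_cast
    -- The field g is controlled only on D; one point in D is enough, because χ vanishes outside.
    have key : ∀ x y, y ∈ D → ‖χ x • g x - χ x • g y‖ ≤ L * dist x y →
        ‖χ x • g x - χ y • g y‖ ≤ (L + c * G) * dist x y := by
      intro x y hy h
      have e : χ x • g x - χ y • g y = (χ x • g x - χ x • g y) + (χ x - χ y) • g y := by
        rw [sub_smul]; abel
      rw [e]
      refine (norm_add_le _ _).trans ?_
      rw [norm_smul, Real.norm_eq_abs, add_mul]
      have h1 : |χ x - χ y| * ‖g y‖ ≤ (c * dist x y) * G :=
        mul_le_mul (hχL x y) (hG y hy) (norm_nonneg _) (by positivity)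
      linarith
    by_cases hx : x ∈ D
    · by_cases hy : y ∈ D
      · refine key x y hy ?_
        rw [← smul_sub, norm_smul, Real.norm_eq_abs, abs_of_nonneg (hχ0 x), ← dist_eq_norm]
        have h1 := hL.dist_le_mul x hx y hy
        calc _ ≤ 1 * dist (g x) (g y) := by gcongr; exact hχ1 x
          _ ≤ _ := by rwa [one_mul]
      · rw [norm_sub_rev, dist_comm]
        refine key y x hx ?_
        rw [hχD y hy, zero_smul, zero_smul, sub_zero, norm_zero]
        positivity
    · by_cases hy : y ∈ D
      · refine key x y hy ?_
        rw [hχD x hx, zero_smul, zero_smul, sub_zero, norm_zero]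
        positivity
      · rw [hχD x hx, hχD y hy, zero_smul, zero_smul, sub_zero, norm_zero]
        positivity
  · rw [norm_neg, norm_smul, Real.norm_eq_abs, abs_of_nonneg (hχ0 x)]
    by_cases hx : x ∈ D
    · calc _ ≤ 1 * (G : ℝ) := by gcongr; exacts [hχ1 x, hG x hx]
        _ = G := one_mul _
    · rw [hχD x hx, zero_mul]
      positivity

end GlobalFlow

/-! ### Gradient flows under a Polyak-Łojasiewicz inequality -/

section GradientFlow

variable {E : Type*} [NormedAddCommGroup E] [NormedSpace ℝ E] {f : E → ℝ} {f' : E → E →L[ℝ] ℝ}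
  {g : E → E} {S : Set E} {χ : E → ℝ} {γ : ℝ → E} {t₀ c : ℝ}

theorem hasDerivWithinAt_comp_flow (hf : ∀ x ∈ S, HasFDerivAt f (f' x) x)
    (hg : ∀ x ∈ S, f' x (g x) = ‖g x‖ ^ 2) {t : ℝ}
    (hγ : HasDerivWithinAt γ (-(χ (γ t) • g (γ t))) (Ici t₀) t) (ht : γ t ∈ S) :
    HasDerivWithinAt (fun t => f (γ t)) (-(χ (γ t) * ‖g (γ t)‖ ^ 2)) (Ici t₀) t := by
  have h := (hf _ ht).comp_hasDerivWithinAt t hγ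
  rwa [map_neg, map_smul, hg _ ht, smul_eq_mul] at h

/-- Continuous induction: the good times are closed since the sublevel set is, and extend to the
right since S is open and f decreases while the curve is in S. The factor χ ≥ 0 lets this apply to
the cut-off flow too. -/
theorem mem_sublevel_of_flow (hS : IsOpen S) (hf : ∀ x ∈ S, HasFDerivAt f (f' x) x)
    (hg : ∀ x ∈ S, f' x (g x) = ‖g x‖ ^ 2) (hclosed : IsClosed {x | x ∈ S ∧ f x ≤ c})
    (hχ : ∀ x, 0 ≤ χ x) (h₀ : γ t₀ ∈ S ∧ f (γ t₀) ≤ c)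
    (hγ : ∀ t, t₀ ≤ t → HasDerivWithinAt γ (-(χ (γ t) • g (γ t))) (Ici t₀) t) {t : ℝ}
    (ht : t₀ ≤ t) : γ t ∈ S ∧ f (γ t) ≤ c := by
  have hcont : ContinuousOn γ (Ici t₀) := fun t ht => (hγ t ht).continuousWithinAt
  have hsub : Icc t₀ t ⊆ γ ⁻¹' {x | x ∈ S ∧ f x ≤ c} := by
    refine IsClosed.Icc_subset_of_forall_mem_nhdsWithin ?_ h₀ ?_
    · rw [inter_comm]
      exact (hcont.mono Icc_subset_Ici_self).preimage_isClosed_of_isClosed isClosed_Icc hclosed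
    · rintro x ⟨⟨hxS, hxc⟩, hx, -⟩
      have hev : ∀ᶠ y in 𝓝[≥] x, γ y ∈ S :=
        ((hγ x hx).continuousWithinAt.mono (Ici_subset_Ici.2 hx)).eventually (hS.mem_nhds hxS)
      obtain ⟨u, hu, huS⟩ := mem_nhdsGE_iff_exists_Ico_subset.1 hev
      have hanti : AntitoneOn (fun t => f (γ t)) (Ico x u) := by
        have hd : ∀ y ∈ Ico x u, HasDerivWithinAt (fun t => f (γ t))
            (-(χ (γ y) * ‖g (γ y)‖ ^ 2)) (Ici t₀) y := fun y hy =>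
          hasDerivWithinAt_comp_flow hf hg (hγ y (hx.trans hy.1)) (huS hy)
        have hIco : Ico x u ⊆ Ici t₀ := fun y hy => hx.trans hy.1
        refine antitoneOn_of_hasDerivWithinAt_nonpos (convex_Ico x u)
          (fun y hy => (hd y hy).continuousWithinAt.mono hIco)
          (fun y hy => (hd y (interior_subset hy)).mono (interior_subset.trans hIco))
          (fun y _ => neg_nonpos.2 (mul_nonneg (hχ _) (sq_nonneg _)))
      filter_upwards [Ioo_mem_nhdsGT hu] with y hy
      exact ⟨huS ⟨hy.1.le, hy.2⟩,
        (hanti ⟨le_rfl, hu⟩ ⟨hy.1.le, hy.2⟩ hy.1.le).trans hxc⟩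
  exact hsub ⟨ht, le_rfl⟩

theorem exists_gradientFlow [FiniteDimensional ℝ E] (hS : IsOpen S)
    (hf : ∀ x ∈ S, HasFDerivAt f (f' x) x) (hg : ∀ x ∈ S, f' x (g x) = ‖g x‖ ^ 2)
    (hgd : ∀ x ∈ S, ContDiffAt ℝ 1 g x) {x₀ : E} (hx₀ : x₀ ∈ S)
    (hcpt : IsCompact {x | x ∈ S ∧ f x ≤ f x₀}) (t₀ : ℝ) :
    ∃ γ : ℝ → E, γ t₀ = x₀ ∧ ∀ t, t₀ ≤ t → HasDerivWithinAt γ (-g (γ t)) (Ici t₀) t := by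
  have : CompleteSpace E := FiniteDimensional.complete ℝ E
  obtain ⟨χ, hχ0, hχ1, L, B, hL, hB⟩ := exists_cutoff_lipschitz hS hcpt (fun x hx => hx.1) hgd
  obtain ⟨γ, h0, hγ⟩ := exists_forall_hasDerivWithinAt_Ici_of_lipschitzWith hL hB t₀ x₀
  refine ⟨γ, h0, fun t ht => ?_⟩
  have hmem := mem_sublevel_of_flow (c := f x₀) hS hf hg hcpt.isClosed hχ0
    (by rw [h0]; exact ⟨hx₀, le_rfl⟩) hγ ht
  have h := hγ t ht
  rwa [hχ1 _ hmem, one_smul] at h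

/-! ### Decay of the value and length of the trajectory -/

variable {xs : E} {μ : ℝ}

theorem sub_le_exp_of_gradientFlow (hf : ∀ x ∈ S, HasFDerivAt f (f' x) x)
    (hg : ∀ x ∈ S, f' x (g x) = ‖g x‖ ^ 2)
    (hγ : ∀ t, t₀ ≤ t → HasDerivWithinAt γ (-g (γ t)) (Ici t₀) t)
    (hγS : ∀ t, t₀ ≤ t → γ t ∈ S) (hPL : ∀ t, t₀ ≤ t → 2 * μ * (f (γ t) - f xs) ≤ ‖g (γ t)‖ ^ 2)
    {t : ℝ} (ht : t₀ ≤ t) :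
    f (γ t) - f xs ≤ (f (γ t₀) - f xs) * Real.exp (-(2 * μ * (t - t₀))) := by
  have hd : ∀ t ∈ Ici t₀, HasDerivWithinAt
      (fun t => (f (γ t) - f xs) * Real.exp (2 * μ * (t - t₀)))
      (-‖g (γ t)‖ ^ 2 * Real.exp (2 * μ * (t - t₀)) +
        (f (γ t) - f xs) * (Real.exp (2 * μ * (t - t₀)) * (2 * μ))) (Ici t₀) t := by
    intro t ht
    have h1 := hasDerivWithinAt_comp_flow (χ := fun _ => 1) hf hg
      (by simpa using hγ t ht) (hγS t ht)
    rw [one_mul] at h1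
    have h2 : HasDerivAt (fun t => Real.exp (2 * μ * (t - t₀)))
        (Real.exp (2 * μ * (t - t₀)) * (2 * μ)) t := by
      simpa using (((hasDerivAt_id t).sub_const t₀).const_mul (2 * μ)).exp
    exact (h1.sub_const (f xs)).mul h2.hasDerivWithinAt
  have hanti : AntitoneOn (fun t => (f (γ t) - f xs) * Real.exp (2 * μ * (t - t₀))) (Ici t₀) := by
    refine antitoneOn_of_hasDerivWithinAt_nonpos (convex_Ici t₀)
      (fun t ht => (hd t ht).continuousWithinAt)
      (fun t ht => (hd t (interior_subset ht)).mono interior_subset) fun t ht => ?_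
    have h1 := hPL t (interior_subset ht)
    have h2 := Real.exp_pos (2 * μ * (t - t₀))
    nlinarith
  have h := hanti (mem_Ici.2 le_rfl) (mem_Ici.2 ht) ht
  simp only [sub_self, mul_zero, Real.exp_zero, mul_one] at h
  rw [Real.exp_neg, ← div_eq_mul_inv, le_div_iff₀ (Real.exp_pos _)]
  exact h

theorem norm_gradientFlow_sub_le (hμ : 0 < μ) (hf : ∀ x ∈ S, HasFDerivAt f (f' x) x)
    (hg : ∀ x ∈ S, f' x (g x) = ‖g x‖ ^ 2)
    (hγ : ∀ t, t₀ ≤ t → HasDerivWithinAt γ (-g (γ t)) (Ici t₀) t)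
    (hγS : ∀ t, t₀ ≤ t → γ t ∈ S) (hPL : ∀ t, t₀ ≤ t → 2 * μ * (f (γ t) - f xs) ≤ ‖g (γ t)‖ ^ 2)
    {t u : ℝ} (ht : t₀ ≤ t) (htu : t ≤ u) (hpos : ∀ v ∈ Ico t u, 0 < f (γ v) - f xs) :
    ‖γ u - γ t‖ ≤ √(2 * (f (γ t) - f xs) / μ) := by
  have hsub : ∀ v ∈ Icc t u, t₀ ≤ v := fun v hv => ht.trans hv.1
  have hfγ : ∀ v ∈ Icc t u, HasDerivWithinAt (fun t => f (γ t)) (-‖g (γ v)‖ ^ 2) (Ici t₀) v := by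
    intro v hv
    have h1 := hasDerivWithinAt_comp_flow (χ := fun _ => 1) hf hg
      (by simpa using hγ v (hsub v hv)) (hγS v (hsub v hv))
    rwa [one_mul] at h1
  -- By gradient dominance the speed of γ is at most b', so b bounds the distance travelled.
  -- Positivity of f - f(xs) before time u is needed to differentiate the root.
  set b : ℝ → ℝ := fun v => √(2 / μ) * (√(f (γ t) - f xs) - √(f (γ v) - f xs)) with hb
  have key := image_norm_le_of_norm_deriv_right_le_deriv_boundary'
    (f := fun v => γ v - γ t) (f' := fun v => -g (γ v)) (a := t) (b := u) (B := b)
    (B' := fun v => √(2 / μ) * (‖g (γ v)‖ ^ 2 / (2 * √(f (γ v) - f xs))))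
    ?_ ?_ ?_ ?_ ?_ ?_ (right_mem_Icc.2 htu)
  · refine key.trans ?_
    rw [show 2 * (f (γ t) - f xs) / μ = 2 / μ * (f (γ t) - f xs) by ring,
      Real.sqrt_mul (by positivity)]
    exact mul_le_mul_of_nonneg_left (by linarith [Real.sqrt_nonneg (f (γ u) - f xs)])
      (Real.sqrt_nonneg _)
  · exact fun v hv => ((hγ v (hsub v hv)).continuousWithinAt.mono
      (Icc_subset_Ici_self.trans (Ici_subset_Ici.2 ht))).sub continuousWithinAt_const
  · intro v hv
    exact ((hγ v (ht.trans hv.1)).mono (Ici_subset_Ici.2 (ht.trans hv.1))).sub_const _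
  · simp [hb]
  · intro v hv
    have h1 : ContinuousWithinAt (fun v => f (γ v) - f xs) (Icc t u) v :=
      ((hfγ v hv).continuousWithinAt.mono
        (Icc_subset_Ici_self.trans (Ici_subset_Ici.2 ht))).sub continuousWithinAt_const
    exact continuousWithinAt_const.mul (continuousWithinAt_const.sub h1.sqrt)
  · intro v hv
    have h1 := (((hfγ v (Ico_subset_Icc_self hv)).mono
      (Ici_subset_Ici.2 (ht.trans hv.1))).sub_const (f xs)).sqrt (hpos v hv).ne'
    have h2 := (h1.const_sub √(f (γ t) - f xs)).const_mul √(2 / μ)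
    exact h2.congr_deriv (by rw [neg_div, neg_neg])
  · intro v hv
    have hp := hpos v hv
    have hP := hPL v (ht.trans hv.1)
    rw [norm_neg]
    have h1 : √(2 / μ) * √(2 * μ * (f (γ v) - f xs)) = 2 * √(f (γ v) - f xs) := by
      rw [← Real.sqrt_mul (by positivity), show 2 / μ * (2 * μ * (f (γ v) - f xs)) =
        2 ^ 2 * (f (γ v) - f xs) by field_simp, Real.sqrt_mul (by positivity),
        Real.sqrt_sq (by norm_num)]
    have h2 : √(2 * μ * (f (γ v) - f xs)) ≤ ‖g (γ v)‖ := Real.sqrt_le_iff.2 ⟨norm_nonneg _, hP⟩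
    have h3 : 0 < √(f (γ v) - f xs) := Real.sqrt_pos.2 hp
    rw [← mul_div_assoc, le_div_iff₀ (by positivity), ← h1]
    calc _ ≤ ‖g (γ v)‖ * (√(2 / μ) * ‖g (γ v)‖) := by gcongr
      _ = _ := by ring

/-- The orbit stays in a compact set and f tends to its minimal value along it, so the strict
minimizer is the only possible cluster point. -/
theorem tendsto_gradientFlow (hμ : 0 < μ) (hf : ∀ x ∈ S, HasFDerivAt f (f' x) x)
    (hg : ∀ x ∈ S, f' x (g x) = ‖g x‖ ^ 2) (hcpt : IsCompact {x | x ∈ S ∧ f x ≤ c})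
    (hmin : ∀ x ∈ S, x ≠ xs → f xs < f x)
    (hγ : ∀ t, t₀ ≤ t → HasDerivWithinAt γ (-g (γ t)) (Ici t₀) t)
    (hγS : ∀ t, t₀ ≤ t → γ t ∈ S ∧ f (γ t) ≤ c)
    (hPL : ∀ t, t₀ ≤ t → 2 * μ * (f (γ t) - f xs) ≤ ‖g (γ t)‖ ^ 2) :
    Tendsto γ atTop (𝓝 xs) := by
  have hle : ∀ x ∈ S, f xs ≤ f x := fun x hx => by
    by_cases h : x = xs
    · rw [h]
    · exact (hmin x hx h).le
  have hlim : Tendsto (fun t => f (γ t)) atTop (𝓝 (f xs)) := by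
    have h1 : Tendsto (fun t => f xs + (f (γ t₀) - f xs) * Real.exp (-(2 * μ * (t - t₀)))) atTop
        (𝓝 (f xs)) := by
      have h2 : Tendsto (fun t => -(2 * μ * (t - t₀))) atTop atBot :=
        tendsto_neg_atTop_atBot.comp
          ((tendsto_atTop_add_const_right _ (-t₀) tendsto_id).const_mul_atTop (by positivity))
      simpa using ((Real.tendsto_exp_atBot.comp h2).const_mul (f (γ t₀) - f xs)).const_add (f xs)
    refine tendsto_of_tendsto_of_tendsto_of_le_of_le' tendsto_const_nhds h1 ?_ ?_
    · exact (eventually_ge_atTop t₀).mono fun t ht => hle _ (hγS t ht).1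
    · exact (eventually_ge_atTop t₀).mono fun t ht => by
        linarith [sub_le_exp_of_gradientFlow hf hg hγ (fun t ht => (hγS t ht).1) hPL ht]
  refine hcpt.tendsto_nhds_of_unique_mapClusterPt ((eventually_ge_atTop t₀).mono hγS)
    fun x hx hcl => ?_
  by_contra hne
  have h1 := hcl.continuousAt_comp (hf x hx.1).continuousAt
  have h2 : f x = f xs := by
    by_contra h
    have h3 : (𝓝 (f x) ⊓ map (f ∘ γ) atTop).NeBot := h1
    exact h3.ne ((disjoint_nhds_nhds.2 h).mono_right hlim).eq_bot
  exact (hmin x hx.1 hne).ne' h2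

theorem dist_gradientFlow_le (hμ : 0 < μ) (hf : ∀ x ∈ S, HasFDerivAt f (f' x) x)
    (hg : ∀ x ∈ S, f' x (g x) = ‖g x‖ ^ 2) (hcpt : IsCompact {x | x ∈ S ∧ f x ≤ c})
    (hmin : ∀ x ∈ S, x ≠ xs → f xs < f x)
    (hγ : ∀ t, t₀ ≤ t → HasDerivWithinAt γ (-g (γ t)) (Ici t₀) t)
    (hγS : ∀ t, t₀ ≤ t → γ t ∈ S ∧ f (γ t) ≤ c)
    (hPL : ∀ t, t₀ ≤ t → 2 * μ * (f (γ t) - f xs) ≤ ‖g (γ t)‖ ^ 2) {t : ℝ} (ht : t₀ ≤ t) :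
    ‖γ t - xs‖ ≤ √(2 * (f (γ t) - f xs) / μ) := by
  have hγS' : ∀ t, t₀ ≤ t → γ t ∈ S := fun t ht => (hγS t ht).1
  have hpos : ∀ v, t₀ ≤ v → γ v ≠ xs → 0 < f (γ v) - f xs := fun v hv hne =>
    sub_pos.2 (hmin _ (hγS' v hv) hne)
  rw [norm_sub_rev]
  by_cases hzero : ∃ u, t ≤ u ∧ γ u = xs
  -- If the minimizer is reached, the length bound is used up to the first hitting time; otherwise
  -- it is used for all u and passed to the limit.
  · set Z : Set ℝ := {u | t ≤ u ∧ γ u = xs} with hZ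
    have hZclosed : IsClosed Z := by
      have hc : ContinuousOn γ (Ici t) := fun v hv =>
        (hγ v (ht.trans hv)).continuousWithinAt.mono (Ici_subset_Ici.2 ht)
      exact hc.preimage_isClosed_of_isClosed isClosed_Ici (isClosed_singleton (x := xs))
    have hbdd : BddBelow Z := ⟨t, fun u hu => hu.1⟩
    have hmem : sInf Z ∈ Z := hZclosed.csInf_mem hzero hbdd
    have h := norm_gradientFlow_sub_le hμ hf hg hγ hγS' hPL ht hmem.1 fun v hv =>
      hpos v (ht.trans hv.1) fun he => absurd (csInf_le hbdd (show v ∈ Z from ⟨hv.1, he⟩))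
        (not_le.2 hv.2)
    rwa [hmem.2] at h
  · have hne : ∀ u, t ≤ u → γ u ≠ xs := fun u hu he => hzero ⟨u, hu, he⟩
    refine le_of_tendsto (((tendsto_gradientFlow hμ hf hg hcpt hmin hγ hγS hPL).sub_const
      (γ t)).norm) ((eventually_ge_atTop t).mono fun u hu => ?_)
    exact norm_gradientFlow_sub_le hμ hf hg hγ hγS' hPL ht hu fun v hv =>
      hpos v (ht.trans hv.1) (hne v hv.1)

end GradientFlow

end

noncomputable section

/-! ### Convergence of the gradient flow of the cost -/

namespace TrackingLQR

variable {n m : ℕ} {s : TrackingLQR n m} {K₀ Kstar : Matrix (Fin m) (Fin n ⊕ Fin n) ℝ}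

theorem hasFDerivAt_cost : ∀ K ∈ s.stabilizing, HasFDerivAt s.cost (fderiv ℝ s.cost K) K :=
  fun _ hK => ((contDiffAt_cost (k := 1) hK).differentiableAt one_ne_zero).hasFDerivAt

theorem fderiv_cost_grad (hQ : s.Q.PosDef) (hR : s.R.PosDef) (hW : s.W.PosDef) :
    ∀ K ∈ s.stabilizing, fderiv ℝ s.cost K (s.grad K) = ‖s.grad K‖ ^ 2 := fun K hK => by
  rw [fderiv_cost_eq_trace_grad hQ hR hW hK, Matrix.frobenius_norm_sq_eq_trace]

theorem exists_lipschitzOnWith_grad [NeZero n] [NeZero m] (hQ : s.Q.PosDef) (hR : s.R.PosDef)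
    (hγ : 0 < s.γ) (hW : s.W.PosDef) (hK₀ : K₀ ∈ s.stabilizing) :
    ∃ L : NNReal, LipschitzOnWith L s.grad (s.sublevel K₀) := by
  refine LocallyLipschitzOn.exists_lipschitzOnWith_of_compact
    (isCompact_sublevel hQ hR hγ hW hK₀) fun K hK => ?_
  obtain ⟨L, t, ht, hL⟩ := (contDiffAt_grad (k := 1) hQ hR hW hK.1).exists_lipschitzOnWith
  exact ⟨L, t, mem_nhdsWithin_of_mem_nhds ht, hL⟩

theorem IsGradientFlow.mem_sublevel [NeZero n] [NeZero m] (hQ : s.Q.PosDef) (hR : s.R.PosDef)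
    (hγ : 0 < s.γ) (hW : s.W.PosDef) (hK₀ : K₀ ∈ s.stabilizing) {t₀ : ℝ}
    {K : ℝ → Matrix (Fin m) (Fin n ⊕ Fin n) ℝ} (hK : s.IsGradientFlow t₀ K₀ K) {t : ℝ}
    (ht : t₀ ≤ t) : K t ∈ s.sublevel K₀ :=
  mem_sublevel_of_flow (χ := fun _ => 1) isOpen_stabilizing hasFDerivAt_cost
    (fderiv_cost_grad hQ hR hW) (isCompact_sublevel hQ hR hγ hW hK₀).isClosed
    (fun _ => zero_le_one) (by rw [hK.1]; exact ⟨hK₀, le_rfl⟩)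
    (fun t ht => by rw [one_smul]; exact hK.2 t ht) ht

theorem IsGradientFlow.cost_sub_le [NeZero n] [NeZero m] (hQ : s.Q.PosDef) (hR : s.R.PosDef)
    (hγ : 0 < s.γ) (hW : s.W.PosDef) (hK₀ : K₀ ∈ s.stabilizing) {t₀ : ℝ}
    {K : ℝ → Matrix (Fin m) (Fin n ⊕ Fin n) ℝ} (hK : s.IsGradientFlow t₀ K₀ K) {μ : ℝ}
    (hPL : s.PLOn μ (s.sublevel K₀) Kstar) {t : ℝ} (ht : t₀ ≤ t) :
    s.cost (K t) - s.cost Kstar ≤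
      (s.cost K₀ - s.cost Kstar) * Real.exp (-(2 * μ * (t - t₀))) := by
  have h := sub_le_exp_of_gradientFlow hasFDerivAt_cost (fderiv_cost_grad hQ hR hW) hK.2
    (fun t ht => (hK.mem_sublevel hQ hR hγ hW hK₀ ht).1)
    (fun t ht => hPL _ (hK.mem_sublevel hQ hR hγ hW hK₀ ht)) ht
  rwa [hK.1] at h

section Optimal

variable [NeZero n] [NeZero m] (hQ : s.Q.PosDef) (hR : s.R.PosDef) (hγ : 0 < s.γ)
  (hW : s.W.PosDef) (hK₀ : K₀ ∈ s.stabilizing) (hs : Kstar ∈ s.stabilizing)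
  (hgap : s.gap Kstar = 0) {t₀ : ℝ} {K : ℝ → Matrix (Fin m) (Fin n ⊕ Fin n) ℝ}
  (hK : s.IsGradientFlow t₀ K₀ K) {μ : ℝ} (hμ : 0 < μ)
  (hPL : s.PLOn μ (s.sublevel K₀) Kstar)

include hQ hR hW hs hgap in
theorem cost_le_of_gap_eq_zero {K' : Matrix (Fin m) (Fin n ⊕ Fin n) ℝ} (hK' : K' ∈ s.stabilizing) :
    s.cost Kstar ≤ s.cost K' := by
  by_cases h : K' = Kstar
  · rw [h]
  · exact (cost_lt_of_gap_eq_zero hQ hR hW hs hgap hK' h).le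

include hQ hR hγ hW hK₀ hs hgap hK hμ hPL

theorem IsGradientFlow.norm_sub_le {t : ℝ} (ht : t₀ ≤ t) :
    ‖K t - Kstar‖ ≤ √(2 * (s.cost (K t) - s.cost Kstar) / μ) :=
  dist_gradientFlow_le hμ hasFDerivAt_cost (fderiv_cost_grad hQ hR hW)
    (isCompact_sublevel hQ hR hγ hW hK₀)
    (fun _ hK' hne => cost_lt_of_gap_eq_zero hQ hR hW hs hgap hK' hne) hK.2
    (fun _ ht => hK.mem_sublevel hQ hR hγ hW hK₀ ht)
    (fun _ ht => hPL _ (hK.mem_sublevel hQ hR hγ hW hK₀ ht)) ht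

theorem IsGradientFlow.norm_sub_le_exp {t : ℝ} (ht : t₀ ≤ t) :
    ‖K t - Kstar‖ ≤
      √(2 * (s.cost K₀ - s.cost Kstar) / μ) * Real.exp (-(μ * (t - t₀))) := by
  have hφ := cost_le_of_gap_eq_zero hQ hR hW hs hgap hK₀
  have h1 := hK.cost_sub_le hQ hR hγ hW hK₀ hPL ht
  refine (hK.norm_sub_le hQ hR hγ hW hK₀ hs hgap hμ hPL ht).trans ?_
  refine Real.sqrt_le_iff.2 ⟨by positivity, ?_⟩
  have e : Real.exp (-(2 * μ * (t - t₀))) = Real.exp (-(μ * (t - t₀))) ^ 2 := by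
    rw [← Real.exp_nat_mul]; congr 1; push_cast; ring
  rw [mul_pow, Real.sq_sqrt (div_nonneg (by linarith) hμ.le), ← e, div_mul_eq_mul_div, mul_assoc]
  gcongr

theorem IsGradientFlow.tendsto_grad : Tendsto (fun t => s.grad (K t)) atTop (𝓝 0) := by
  have hlim : Tendsto K atTop (𝓝 Kstar) :=
    tendsto_gradientFlow hμ hasFDerivAt_cost (fderiv_cost_grad hQ hR hW)
      (isCompact_sublevel hQ hR hγ hW hK₀)
      (fun _ hK' hne => cost_lt_of_gap_eq_zero hQ hR hW hs hgap hK' hne) hK.2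
      (fun _ ht => hK.mem_sublevel hQ hR hγ hW hK₀ ht)
      (fun _ ht => hPL _ (hK.mem_sublevel hQ hR hγ hW hK₀ ht))
  have h := ((contDiffAt_grad (k := 0) hQ hR hW hs).continuousAt.tendsto).comp hlim
  rwa [grad_eq hQ hR hW hs, hgap, Matrix.zero_mul, smul_zero] at h

theorem IsGradientFlow.norm_sub_le_lipschitz {L : NNReal}
    (hL : LipschitzOnWith L s.grad (s.sublevel K₀)) {t : ℝ} (ht : t₀ ≤ t) :
    ‖K t - Kstar‖ ≤
      √(2 * L * (s.cost K₀ - s.cost Kstar)) / μ * Real.exp (-(μ * (t - t₀))) := by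
  refine (hK.norm_sub_le_exp hQ hR hγ hW hK₀ hs hgap hμ hPL ht).trans ?_
  gcongr
  have hφ : 0 ≤ s.cost K₀ - s.cost Kstar :=
    sub_nonneg.2 (cost_le_of_gap_eq_zero hQ hR hW hs hgap hK₀)
  rcases hφ.eq_or_lt with h0 | hpos
  · simp [← h0]
  have h1 := hK.norm_sub_le hQ hR hγ hW hK₀ hs hgap hμ hPL le_rfl
  rw [hK.1] at h1
  have hmem : Kstar ∈ s.sublevel K₀ := ⟨hs, sub_nonneg.1 hφ⟩
  have hgrad0 : s.grad Kstar = 0 := by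
    rw [grad_eq hQ hR hW hs, hgap, Matrix.zero_mul, smul_zero]
  have h2 := hL.dist_le_mul K₀ ⟨hK₀, le_rfl⟩ Kstar hmem
  rw [dist_eq_norm, dist_eq_norm, hgrad0, sub_zero] at h2
  have h3 := hPL K₀ ⟨hK₀, le_rfl⟩
  set φ := s.cost K₀ - s.cost Kstar
  have h4 : 2 * μ * φ ≤ L ^ 2 * (2 * φ / μ) := by
    calc 2 * μ * φ ≤ ‖s.grad K₀‖ ^ 2 := h3
      _ ≤ (L * √(2 * φ / μ)) ^ 2 := by
        gcongr
        exact h2.trans (by gcongr)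
      _ = _ := by rw [mul_pow, Real.sq_sqrt (by positivity)]
  -- Gradient dominance, the Lipschitz bound and the distance bound at time t₀ give 2μφ ≤ ‖∇f(K₀)‖²
  -- ≤ L² · 2φ/μ. Hence the third estimate is a weakening of the second.
  have h5 : μ ≤ L := by
    have h6 : μ ^ 2 ≤ (L : ℝ) ^ 2 := by
      rw [← mul_div_assoc, le_div_iff₀ hμ] at h4
      refine le_of_mul_le_mul_right ?_ (by positivity : 0 < 2 * φ)
      linarith
    exact (sq_le_sq₀ hμ.le L.2).1 h6
  rw [le_div_iff₀ hμ]
  refine Real.le_sqrt_of_sq_le ?_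
  rw [mul_pow, Real.sq_sqrt (by positivity)]
  have e : 2 * φ / μ * μ ^ 2 = 2 * μ * φ := by field_simp
  rw [e]
  gcongr

end Optimal

end TrackingLQR

end

/-! ### The main theorem -/

theorem theorem2 {n m : ℕ} (hn : 0 < n) (hm : 0 < m) (s : TrackingLQR n m)
    (hQ : s.Q.PosDef) (hR : s.R.PosDef) (hγ : 0 < s.γ) (hW : s.W.PosDef)
    (K₀ : Matrix (Fin m) (Fin n ⊕ Fin n) ℝ) (hK₀ : K₀ ∈ s.stabilizing) :
    -- the gradient is a genuine one on the set of stabilizing gains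
    IsOpen s.stabilizing ∧ (∀ K ∈ s.stabilizing, DifferentiableAt ℝ s.cost K) ∧
    -- the Riccati solution and the optimal gain
    ∃ (Pstar : Matrix (Fin n ⊕ Fin n) (Fin n ⊕ Fin n) ℝ)
      (Kstar : Matrix (Fin m) (Fin n ⊕ Fin n) ℝ),
      Pstar.PosSemidef ∧ s.Riccati Pstar ∧
      (∀ P : Matrix (Fin n ⊕ Fin n) (Fin n ⊕ Fin n) ℝ,
        P.PosSemidef → s.Riccati P → P = Pstar) ∧
      Kstar = s.R⁻¹ * s.augBᵀ * Pstar ∧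
      Kstar ∈ s.stabilizing ∧
      (∀ K ∈ s.stabilizing, K ≠ Kstar → s.cost Kstar < s.cost K) ∧
      -- Lipschitz and gradient dominance constants on the sublevel set exist
      (∃ L : NNReal, LipschitzOnWith L s.grad (s.sublevel K₀)) ∧
      0 < s.rate K₀ ∧ s.PLOn (s.rate K₀) (s.sublevel K₀) Kstar ∧
      -- the gradient flow exists for all times, and every solution converges exponentially
      ∀ t₀ : ℝ,
        (∃ K : ℝ → Matrix (Fin m) (Fin n ⊕ Fin n) ℝ, s.IsGradientFlow t₀ K₀ K) ∧
        ∀ K : ℝ → Matrix (Fin m) (Fin n ⊕ Fin n) ℝ, s.IsGradientFlow t₀ K₀ K →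
          (∀ t, t₀ ≤ t → K t ∈ s.sublevel K₀) ∧
          Tendsto (fun t => s.grad (K t)) atTop (𝓝 0) ∧
          ∀ μ : ℝ, 0 < μ → s.PLOn μ (s.sublevel K₀) Kstar → ∀ t, t₀ ≤ t →
            s.cost (K t) - s.cost Kstar ≤
              (s.cost K₀ - s.cost Kstar) * Real.exp (-(2 * μ * (t - t₀))) ∧
            ‖K t - Kstar‖ ≤
              √(2 * (s.cost K₀ - s.cost Kstar) / μ) * Real.exp (-(μ * (t - t₀))) ∧
            ∀ L : NNReal, LipschitzOnWith L s.grad (s.sublevel K₀) →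
              ‖K t - Kstar‖ ≤
                √(2 * L * (s.cost K₀ - s.cost Kstar)) / μ * Real.exp (-(μ * (t - t₀))) := by

  have : NeZero n := ⟨hn.ne'⟩
  have : NeZero m := ⟨hm.ne'⟩
  obtain ⟨Ks, hs, hgap⟩ := TrackingLQR.exists_gap_eq_zero hQ hR hγ hW hK₀
  have hPs := TrackingLQR.posSemidef_valueMatrix hQ hR hs
  have hRK := TrackingLQR.mul_eq_of_gap_eq_zero hgap
  have hdet : IsUnit s.R.det := (Matrix.isUnit_iff_isUnit_det _).1 hR.isUnit
  have hmem : Ks ∈ s.sublevel K₀ :=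
    ⟨hs, TrackingLQR.cost_le_of_gap_eq_zero hQ hR hW hs hgap hK₀⟩
  have hrate := TrackingLQR.rate_pos hQ hR hγ hW hK₀
  have hPL := TrackingLQR.plOn_rate hQ hR hγ hW hK₀ hmem
  refine ⟨TrackingLQR.isOpen_stabilizing,
    fun K hK => (TrackingLQR.hasFDerivAt_cost K hK).differentiableAt,
    s.valueMatrix Ks, Ks, hPs,
    (TrackingLQR.riccati_iff hR (Matrix.posSemidef_real_iff.1 hPs).1 hRK).2
      (TrackingLQR.valueMatrix_spec hs),
    fun P hP hric => TrackingLQR.riccati_unique hQ hR hW hs hgap hP hric, ?_, hs,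
    fun K hK hne => TrackingLQR.cost_lt_of_gap_eq_zero hQ hR hW hs hgap hK hne,
    TrackingLQR.exists_lipschitzOnWith_grad hQ hR hγ hW hK₀, hrate, hPL, fun t₀ => ⟨?_, ?_⟩⟩
  · rw [Matrix.mul_assoc, ← hRK, ← Matrix.mul_assoc, Matrix.nonsing_inv_mul _ hdet, Matrix.one_mul]
  · exact exists_gradientFlow TrackingLQR.isOpen_stabilizing TrackingLQR.hasFDerivAt_cost
      (TrackingLQR.fderiv_cost_grad hQ hR hW)
      (fun K hK => TrackingLQR.contDiffAt_grad hQ hR hW hK) hK₀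
      (TrackingLQR.isCompact_sublevel hQ hR hγ hW hK₀) t₀
  · intro K hK
    refine ⟨fun t ht => hK.mem_sublevel hQ hR hγ hW hK₀ ht,
      hK.tendsto_grad hQ hR hγ hW hK₀ hs hgap hrate hPL, fun μ hμ hPLμ t ht =>
      ⟨hK.cost_sub_le hQ hR hγ hW hK₀ hPLμ ht,
        hK.norm_sub_le_exp hQ hR hγ hW hK₀ hs hgap hμ hPLμ ht,
        fun L hL => hK.norm_sub_le_lipschitz hQ hR hγ hW hK₀ hs hgap hμ hPLμ hL ht⟩⟩
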